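/- Let $n\ge 0$ and let $s=(s(1),\dots,s(n))$ be a weak composition, i.e. a sequence of non-negative integers. An $s$-decreasing tree is a planar rooted tree with $n$ internal vertices labeled bijectively by $1,\dots,n$ (leaves are unlabeled), such that vertex $i$ has $s(i)+1$ children, indexed $0,\dots,s(i)$ from left to right, and all labeled proper descendants of $i$ have labels less than $i$. For such a tree $T$ let $T^y_j$ be the full subtree rooted at the $j$-th child of $y$. For $x<y$ define $\#_T(y,x)=0$ if $x$ is left of $y$ or $x\in T^y_0$; $\#_T(y,x)=i$ if $x\in T^y_i$ with $0<i<s(y)$; and $\#_T(y,x)=s(y)$ if $x\in T^y_{s(y)}$ or $x$ is right of $y$. Let $\mathrm{inv}(T)$ be the multiset of pairs $(y,x)$, $x<y$, with multiplicities $\#_T(y,x)$. The $s$-weak order is the partial order on $s$-decreasing trees given by $T\preceq Z$ if and only if $\mathrm{inv}(T)\subseteq\mathrm{inv}(Z)$ (as multisets). A pair $(a,b)$ with $a<b$ is a tree ascent of $T$ if (i) $a\in T^b_i$ for some $0\le i<s(b)$; (ii) whenever $a<e<b$ and $a\in T^e_j$, then $j=s(e)$; (iii) if $s(a)>0$, then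 $T^a_{s(a)}$ is a leaf. A multiset $I$ of pairs $(y,x)$ with $x<y$, with multiplicities $\#_I(y,x)$, is transitive if for all $a<b<c$ either $\#_I(b,a)=0$ or $\#_I(c,a)\ge \#_I(c,b)$; the transitive closure $I^{tc}$ is the smallest transitive multiset of such pairs containing $I$. If $(a,b)$ is a tree ascent of $T$, the $s$-tree rotation of $T$ along $(a,b)$ is the $s$-decreasing tree $Z$ with $\mathrm{inv}(Z)=(\mathrm{inv}(T)+(b,a))^{tc}$, where $+(b,a)$ increases the multiplicity of $(b,a)$ by one and multiplicities of pairs $(y,x)$ are capped at $s(y)$. An SB-labeling of a finite lattice $L$ is a labeling $\lambda$ of the cover relations of $L$ such that for all $u,v,w\in L$ with $v\ne w$ both covering $u$: (i) $\lambda(u,v)\neq\lambda(u,w)$; (ii) every saturated chain from $u$ to $v\vee w$ uses each of the labels $\lambda(u,v)$ and $\lambda(u,w)$ at least once; (iii) no saturated chain from $u$ to $v\vee w$ uses any other label. Theorem. For every weak composition $s$: (1) for every cover relation $T\lessdot Z$ of the $s$-weak order there is a unique tree ascent $(a,b)$ of $T$ such that $Z$ is the $s$-tree rotation of $T$ along $(a,b)$;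 (2) the $s$-weak order is a finite lattice, and the edge labeling $\lambda(T,Z)=a$, where $(a,b)$ is the tree ascent in (1), is an SB-labeling of it; (3) whenever $Z\ne Q$ both cover $T$, the interval $[T,Z\vee Q]$ is a diamond, a pentagon or a hexagon, i.e. it consists of a bottom element, a top element and two disjoint chains between them, with no comparabilities between one chain and the other, having $1$ and $1$, $1$ and $2$, or $2$ and $2$ elements, respectively. -/

import Mathlib

/-- Planar rooted trees whose leaves are unlabeled and in which every internal vertex carries a
label `i : Fin n` and has exactly `s i + 1` children, indexed from left to right by `0, …, s i`.
The label set `{1, …, n}` is modelled by `Fin n`. -/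
inductive PlanarTree {n : ℕ} (s : Fin n → ℕ) : Type
  | leaf : PlanarTree s
  | node (i : Fin n) (child : Fin (s i + 1) → PlanarTree s) : PlanarTree s

namespace PlanarTree

variable {n : ℕ} {s : Fin n → ℕ}

/-- The multiset of labels of the internal vertices. -/
def labels : PlanarTree s → Multiset (Fin n)
  | leaf => 0
  | node i child => i ::ₘ ∑ k, (child k).labels

/-- All labeled proper descendants of an internal vertex have a smaller label. -/
def Decreasing : PlanarTree s → Prop
  | leaf => True
  | node i child => ∀ k, (∀ x ∈ (child k).labels, x < i) ∧ (child k).Decreasing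

/-- `T.InChild y j x`: the vertex labeled `x` lies in `T^y_j`, the full subtree of `T` rooted at
the `j`-th child of the vertex labeled `y`. -/
def InChild : PlanarTree s → Fin n → ℕ → Fin n → Prop
  | leaf, _, _, _ => False
  | node i child, y, j, x =>
      (i = y ∧ ∃ k : Fin (s i + 1), (k : ℕ) = j ∧ x ∈ (child k).labels) ∨ ∃ k, (child k).InChild y j x

/-- `T.LeftOf x y`: the vertex labeled `x` is to the left of the vertex labeled `y`, that is, some
vertex of `T` has `x` below one of its children and `y` below a child further to the right. -/
def LeftOf : PlanarTree s → Fin n → Fin n → Prop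
  | leaf, _, _ => False
  | node _ child, x, y =>
      (∃ k l, k < l ∧ x ∈ (child k).labels ∧ y ∈ (child l).labels) ∨ ∃ k, (child k).LeftOf x y

open Classical in
/-- The cardinality `#_T(y, x)`, used for `x < y`: it is `0` if `x` is left of `y` or
`x ∈ T^y_0`; it is `i` if `x ∈ T^y_i` with `0 < i < s y`; it is `s y` in the remaining case,
i.e. if `x ∈ T^y_{s y}` or `x` is right of `y`. -/
noncomputable def card (T : PlanarTree s) (y x : Fin n) : ℕ :=
  if T.LeftOf x y ∨ T.InChild y 0 x then 0
  else if h : ∃ i, 0 < i ∧ i < s y ∧ T.InChild y i x then h.choose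
  else s y

theorem mem_labels_node {i : Fin n} {child : Fin (s i + 1) → PlanarTree s} {x : Fin n} :
    x ∈ (node i child).labels ↔ x = i ∨ ∃ k, x ∈ (child k).labels := by
  simp [labels, Multiset.mem_sum]

theorem InChild.mem {T : PlanarTree s} {y x : Fin n} {j : ℕ} (h : T.InChild y j x) :
    y ∈ T.labels ∧ x ∈ T.labels := by
  induction T with
  | leaf => exact h.elim
  | node i child ih =>
    rw [mem_labels_node, mem_labels_node]
    rcases h with ⟨rfl, k, -, hx⟩ | ⟨k, hk⟩
    · exact ⟨Or.inl rfl, Or.inr ⟨k, hx⟩⟩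
    · exact ⟨Or.inr ⟨k, (ih k hk).1⟩, Or.inr ⟨k, (ih k hk).2⟩⟩

theorem LeftOf.mem {T : PlanarTree s} {x y : Fin n} (h : T.LeftOf x y) :
    x ∈ T.labels ∧ y ∈ T.labels := by
  induction T with
  | leaf => exact h.elim
  | node i child ih =>
    rw [mem_labels_node, mem_labels_node]
    rcases h with ⟨k, l, -, hx, hy⟩ | ⟨k, hk⟩
    · exact ⟨Or.inr ⟨k, hx⟩, Or.inr ⟨l, hy⟩⟩
    · exact ⟨Or.inr ⟨k, (ih k hk).1⟩, Or.inr ⟨k, (ih k hk).2⟩⟩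

theorem nodup_child {i : Fin n} {child : Fin (s i + 1) → PlanarTree s}
    (h : (node i child).labels.Nodup) (k : Fin (s i + 1)) : (child k).labels.Nodup := by
  refine Multiset.nodup_of_le ?_ (Multiset.nodup_cons.1 h).2
  exact Finset.single_le_sum (f := fun k => (child k).labels) (fun _ _ => Multiset.zero_le _)
    (Finset.mem_univ k)

theorem child_unique {i : Fin n} {child : Fin (s i + 1) → PlanarTree s}
    (h : (node i child).labels.Nodup) {k l : Fin (s i + 1)} {x : Fin n}
    (hk : x ∈ (child k).labels) (hl : x ∈ (child l).labels) : k = l := by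
  by_contra hne
  have h1 := Multiset.nodup_iff_count_le_one.1 (Multiset.nodup_cons.1 h).2 x
  rw [Multiset.count_sum'] at h1
  have h2 : ∑ m ∈ ({k, l} : Finset _), ((child m).labels.count x) ≤
      ∑ m, (child m).labels.count x :=
    Finset.sum_le_sum_of_subset (Finset.subset_univ _)
  rw [Finset.sum_pair hne] at h2
  have := Multiset.count_pos.2 hk
  have := Multiset.count_pos.2 hl
  omega

theorem card_root {i : Fin n} {child : Fin (s i + 1) → PlanarTree s}
    (h : (node i child).labels.Nodup) {k : Fin (s i + 1)} {x : Fin n}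
    (hk : x ∈ (child k).labels) : (node i child).card i x = k := by
  have hi : ∀ l, i ∉ (child l).labels := fun l hl =>
    (Multiset.nodup_cons.1 h).1 (Multiset.mem_sum.2 ⟨l, Finset.mem_univ _, hl⟩)
  have hL : ¬ (node i child).LeftOf x i := by
    rintro (⟨_, l, -, -, hl⟩ | ⟨l, hl⟩)
    · exact hi l hl
    · exact hi l hl.mem.2
  have hI : ∀ j, (node i child).InChild i j x ↔ j = k := by
    intro j
    constructor
    · rintro (⟨-, l, rfl, hl⟩ | ⟨l, hl⟩)
      · rw [child_unique h hl hk]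
      · exact (hi l hl.mem.1).elim
    · rintro rfl
      exact Or.inl ⟨rfl, k, rfl, hk⟩
  have hlt := k.isLt
  unfold card
  split_ifs with h1 h2
  · exact (hI 0).1 (h1.resolve_left hL)
  · exact (hI _).1 h2.choose_spec.2.2
  · have h3 : ¬ (0 = (k : ℕ)) := fun h0 => h1 (Or.inr ((hI 0).2 h0))
    have h4 : ¬ ((k : ℕ) < s i) := fun h0 => h2 ⟨k, by omega, h0, (hI _).2 rfl⟩
    omega

theorem card_child {i : Fin n} {child : Fin (s i + 1) → PlanarTree s}
    (h : (node i child).labels.Nodup) {k : Fin (s i + 1)} {x y : Fin n}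
    (hx : x ∈ (child k).labels) (hy : y ∈ (child k).labels) :
    (node i child).card y x = (child k).card y x := by
  have hyi : i ≠ y := by
    rintro rfl
    exact (Multiset.nodup_cons.1 h).1 (Multiset.mem_sum.2 ⟨k, Finset.mem_univ _, hy⟩)
  have hL : (node i child).LeftOf x y ↔ (child k).LeftOf x y := by
    constructor
    · rintro (⟨a, b, hab, ha, hb⟩ | ⟨l, hl⟩)
      · rw [child_unique h ha hx, child_unique h hb hy] at hab
        exact (lt_irrefl _ hab).elim
      · rwa [child_unique h hl.mem.1 hx] at hl
    · exact fun hl => Or.inr ⟨k, hl⟩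
  have hI : ∀ j, (node i child).InChild y j x ↔ (child k).InChild y j x := by
    intro j
    constructor
    · rintro (⟨h0, -⟩ | ⟨l, hl⟩)
      · exact (hyi h0).elim
      · rwa [child_unique h hl.mem.1 hy] at hl
    · exact fun hl => Or.inr ⟨k, hl⟩
  have hI' : (fun j => (node i child).InChild y j x) = fun j => (child k).InChild y j x :=
    funext fun j => propext (hI j)
  have h0 : ∀ (L L' : Prop) (C C' : ℕ → Prop) (_ : L = L') (_ : C = C'),
      (open Classical in (if L ∨ C 0 then 0
        else if h : ∃ j, 0 < j ∧ j < s y ∧ C j then h.choose else s y)) =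
      (open Classical in (if L' ∨ C' 0 then 0
        else if h : ∃ j, 0 < j ∧ j < s y ∧ C' j then h.choose else s y)) := by
    rintro L _ C _ rfl rfl
    rfl
  exact h0 _ _ _ _ (propext hL) hI'

/-- A decreasing tree without repeated labels is determined by its labels and cardinalities. -/
theorem eq_of_card_eq (T T' : PlanarTree s) (hT : T.Decreasing) (hT' : T'.Decreasing)
    (hl : T.labels = T'.labels) (hn : T.labels.Nodup)
    (hc : ∀ y x, x < y → x ∈ T.labels → y ∈ T.labels → T.card y x = T'.card y x) : T = T' := by
  induction T generalizing T' with
  | leaf =>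
    cases T' with
    | leaf => rfl
    | node i' child' => exact (Multiset.cons_ne_zero hl.symm).elim
  | node i child ih =>
    cases T' with
    | leaf => exact (Multiset.cons_ne_zero hl).elim
    | node i' child' =>
      have hii : i = i' := by
        have h1 : i ∈ (node i' child').labels := hl ▸ mem_labels_node.2 (Or.inl rfl)
        have h2 : i' ∈ (node i child).labels := hl ▸ mem_labels_node.2 (Or.inl rfl)
        rcases mem_labels_node.1 h1 with h1 | ⟨k, h1⟩
        · exact h1
        · rcases mem_labels_node.1 h2 with h2 | ⟨l, h2⟩
          · exact h2.symm
          · exact (lt_asymm ((hT' k).1 _ h1) ((hT l).1 _ h2)).elim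
      subst hii
      have hn' : (node i child').labels.Nodup := hl ▸ hn
      have key : ∀ k x, x ∈ (child k).labels ↔ x ∈ (child' k).labels := by
        intro k x
        constructor
        · intro hx
          have hxi := (hT k).1 x hx
          have hm : x ∈ (node i child).labels := mem_labels_node.2 (Or.inr ⟨k, hx⟩)
          have hm' : x ∈ (node i child').labels := hl ▸ hm
          rcases mem_labels_node.1 hm' with h1 | ⟨l, h1⟩
          · exact (hxi.ne h1).elim
          · have := hc i x hxi hm (mem_labels_node.2 (Or.inl rfl))
            rw [card_root hn hx, card_root hn' h1] at this
            rwa [Fin.ext this]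
        · intro hx
          have hxi := (hT' k).1 x hx
          have hm' : x ∈ (node i child').labels := mem_labels_node.2 (Or.inr ⟨k, hx⟩)
          have hm : x ∈ (node i child).labels := hl ▸ hm'
          rcases mem_labels_node.1 hm with h1 | ⟨l, h1⟩
          · exact (hxi.ne h1).elim
          · have := hc i x hxi hm (mem_labels_node.2 (Or.inl rfl))
            rw [card_root hn h1, card_root hn' hx] at this
            rwa [← Fin.ext this]
      congr 1
      funext k
      refine ih k (child' k) (hT k).2 (hT' k).2 ?_ (nodup_child hn k) ?_
      · exact (Multiset.Nodup.ext (nodup_child hn k) (nodup_child hn' k)).2 (key k)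
      · intro y x hxy hx hy
        rw [← card_child hn hx hy, ← card_child hn' ((key k x).1 hx) ((key k y).1 hy)]
        exact hc y x hxy (mem_labels_node.2 (Or.inr ⟨k, hx⟩)) (mem_labels_node.2 (Or.inr ⟨k, hy⟩))

end PlanarTree

/-- `s`-decreasing trees for the weak composition `s = (s(1), …, s(n))`: planar rooted trees with
`n` internal vertices, labeled bijectively by the `n` labels, such that the vertex `i` has
`s i + 1` children and all labeled descendants of `i` have labels less than `i`. -/
@[ext]
structure SDecreasingTree {n : ℕ} (s : Fin n → ℕ) where
  tree : PlanarTree s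
  labels_eq : tree.labels = Finset.univ.val
  decreasing : tree.Decreasing

/-- Multi-inversion sets on `[n]`: multisets of pairs `(y, x)` with `x < y`, given by their
multiplicities. -/
@[ext]
structure MultiInversionSet (n : ℕ) where
  mult : Fin n → Fin n → ℕ
  mult_eq_zero : ∀ y x, ¬ x < y → mult y x = 0

namespace MultiInversionSet

variable {n : ℕ}

/-- Inclusion of multi-inversion sets. -/
instance : PartialOrder (MultiInversionSet n) :=
  PartialOrder.lift mult fun _ _ h => MultiInversionSet.ext h

/-- Transitivity of a multi-inversion set. -/
def Transitive (I : MultiInversionSet n) : Prop :=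
  ∀ a b c : Fin n, a < b → b < c → I.mult b a = 0 ∨ I.mult c b ≤ I.mult c a

/-- `K` is the transitive closure of `I`: the smallest transitive multi-inversion set
containing `I`. -/
def IsTransitiveClosure (I K : MultiInversionSet n) : Prop :=
  IsLeast {J : MultiInversionSet n | J.Transitive ∧ I ≤ J} K

/-- The sum `I + (b, a)`, where the multiplicity of a pair `(y, x)` is capped at `s y`. -/
def addPair (s : Fin n → ℕ) (I : MultiInversionSet n) (b a : Fin n) : MultiInversionSet n where
  mult y x := if x < y then min (I.mult y x + if y = b ∧ x = a then 1 else 0) (s y) else 0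
  mult_eq_zero _ _ h := if_neg h

end MultiInversionSet

namespace SDecreasingTree

variable {n : ℕ} {s : Fin n → ℕ}

/-- The multiset `inv(T)` of tree inversions of `T`. -/
noncomputable def inv (T : SDecreasingTree s) : MultiInversionSet n where
  mult y x := if x < y then T.tree.card y x else 0
  mult_eq_zero _ _ h := if_neg h

theorem inv_injective : Function.Injective (inv : SDecreasingTree s → MultiInversionSet n) := by
  intro T T' h
  refine SDecreasingTree.ext (PlanarTree.eq_of_card_eq _ _ T.decreasing T'.decreasing
    (T.labels_eq.trans T'.labels_eq.symm) (T.labels_eq ▸ Finset.univ.nodup) ?_)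
  intro y x hxy _ _
  have := congrFun (congrFun (congrArg MultiInversionSet.mult h) y) x
  simpa [inv, hxy] using this

/-- The `s`-weak order: `T ≤ Z` if and only if `inv(T) ⊆ inv(Z)`. -/
noncomputable instance : PartialOrder (SDecreasingTree s) :=
  PartialOrder.lift inv inv_injective

/-- `(a, b)` is a tree ascent of `T`. -/
structure IsTreeAscent (T : SDecreasingTree s) (a b : Fin n) : Prop where
  lt : a < b
  mem_nonlast : ∃ i < s b, T.tree.InChild b i a
  mem_last : ∀ e, a < e → e < b → ∀ j, T.tree.InChild e j a → j = s e
  last_isLeaf : 0 < s a → ∀ x, ¬ T.tree.InChild a (s a) x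

/-- `(a, b)` is a tree ascent of `T`, and `Z` is the `s`-tree rotation of `T` along `(a, b)`:
`inv(Z)` is the transitive closure of `inv(T) + (b, a)`. -/
def IsRotation (T Z : SDecreasingTree s) (a b : Fin n) : Prop :=
  T.IsTreeAscent a b ∧ (T.inv.addPair s b a).IsTransitiveClosure Z.inv

end SDecreasingTree

/-- Edge labelings of (the Hasse diagram of) a poset, with labels in `Λ`. -/
def EdgeLabeling (P : Type*) [PartialOrder P] (Λ : Type*) : Type _ :=
  ∀ ⦃x y : P⦄, x ⋖ y → Λ

/-- Saturated chains `x ⋖ x₁ ⋖ ⋯ ⋖ y` from `x` to `y`. -/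
inductive SaturatedChain {P : Type*} [PartialOrder P] : P → P → Type _
  | nil (x : P) : SaturatedChain x x
  | cons {x y z : P} (h : x ⋖ y) (c : SaturatedChain y z) : SaturatedChain x z

/-- The label sequence of a saturated chain. -/
def SaturatedChain.labels {P Λ : Type*} [PartialOrder P] (lam : EdgeLabeling P Λ) :
    ∀ {x y : P}, SaturatedChain x y → List Λ
  | _, _, nil _ => []
  | _, _, cons h c => lam h :: c.labels lam

/-- `lam` is an SB-labeling: the poset is a finite lattice, and for all distinct `v`, `w` covering
`u`, with join `j`, the labels of `u ⋖ v` and `u ⋖ w` differ, every saturated chain from `u` to `j`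
uses both of these labels, and no such chain uses any other label. -/
structure IsSBLabeling {P Λ : Type*} [PartialOrder P] (lam : EdgeLabeling P Λ) : Prop where
  finite : Finite P
  exists_join : ∀ x y : P, ∃ j, IsLUB {x, y} j
  exists_meet : ∀ x y : P, ∃ m, IsGLB {x, y} m
  label_ne : ∀ ⦃u v w : P⦄ (hv : u ⋖ v) (hw : u ⋖ w), v ≠ w → lam hv ≠ lam hw
  label_mem : ∀ ⦃u v w : P⦄ (hv : u ⋖ v) (hw : u ⋖ w), v ≠ w → ∀ j, IsLUB {v, w} j →
    ∀ c : SaturatedChain u j, lam hv ∈ c.labels lam ∧ lam hw ∈ c.labels lam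
  mem_label : ∀ ⦃u v w : P⦄ (hv : u ⋖ v) (hw : u ⋖ w), v ≠ w → ∀ j, IsLUB {v, w} j →
    ∀ c : SaturatedChain u j, ∀ l ∈ c.labels lam, l = lam hv ∨ l = lam hw

/-- The poset consisting of a bottom element, a top element, and between them two chains with `p`
and `q` elements, where no element of one chain is comparable to an element of the other. -/
abbrev PolygonPoset (p q : ℕ) : Type :=
  WithBot (WithTop (Fin p ⊕ Fin q))

/-! A tree is replaced by its multiplicity function `I y x`. The functions that arise are those
bounded by `s` that are transitive and planar: for `x < y < z`, either `I y x = 0` or `I z y ≤ I z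
x`, and either `I y x = s y` or `I z x ≤ I z y` (`card_transitive`, `card_planar`,
`exists_inv_mult_eq`). The order is then the pointwise one, and everything reduces to integer
inequalities between rows.

Lattice: the pointwise maximum of two such functions is planar, and transitive closure preserves
planarity, so the closure is the join (`exists_isLUB_pair`). Meets follow from finiteness and the
bottom element.

Covers: rotation along an ascent `(a, b)` adds one in row `b`, at `a` and at certain labels below
`a` (`isRotation_iff`). Whenever `I < J`, some ascent of `I` has its rotation below `J`
(`exists_isAscent`), so every cover is a rotation. Its row and the largest label it moves recover
`(a, b)`.

Polygons: two covers of `T` have ascents `(a, b)` and `(c, d)` with, say, `a < c`. Their join lies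
below `doubleRotate`, which exceeds `I` by at most one everywhere. Inside the interval, every
growing pair grows together with `(b, a)`, with `(d, c)` or, only if `b = c`, with `(d, a)`
(`Grows.cases`). So an element is determined by two or three bits, and the third bit is implied by
the first two together and implies one of them. This leaves a diamond, a pentagon or a hexagon. A
rotation inside the interval has as its label the smaller entry of a key pair that it makes grow,
hence `a` or `c`. The bits of `(b, a)` and `(d, c)` must both switch on along any chain to the join,
and they do so at steps labeled `a` and `c` respectively. -/

namespace PlanarTree

/-! ### Transitivity and planarity of the cardinalities of a tree. -/

variable {n : ℕ} {s : Fin n → ℕ}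

theorem root_notMem_child {i : Fin n} {child : Fin (s i + 1) → PlanarTree s}
    (h : (node i child).labels.Nodup) (l : Fin (s i + 1)) : i ∉ (child l).labels := fun hl =>
  (Multiset.nodup_cons.1 h).1 (Multiset.mem_sum.2 ⟨l, Finset.mem_univ _, hl⟩)

theorem card_of_child_lt {i : Fin n} {child : Fin (s i + 1) → PlanarTree s}
    {k l : Fin (s i + 1)} {x y : Fin n} (hkl : k < l)
    (hx : x ∈ (child k).labels) (hy : y ∈ (child l).labels) :
    (node i child).card y x = 0 := by
  unfold card
  exact if_pos (Or.inl (Or.inl ⟨k, l, hkl, hx, hy⟩))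

theorem card_of_lt_child {i : Fin n} {child : Fin (s i + 1) → PlanarTree s}
    (h : (node i child).labels.Nodup) {k l : Fin (s i + 1)} {x y : Fin n} (hkl : l < k)
    (hx : x ∈ (child k).labels) (hy : y ∈ (child l).labels) :
    (node i child).card y x = s y := by
  have hI : ∀ j, ¬ (node i child).InChild y j x := by
    rintro j (⟨rfl, -⟩ | ⟨m, hm⟩)
    · exact root_notMem_child h l hy
    · have h1 := child_unique h hm.mem.1 hy
      have h2 := child_unique h hm.mem.2 hx
      exact hkl.ne (h1.symm.trans h2)
  have hL : ¬ (node i child).LeftOf x y := by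
    rintro (⟨p, q, hpq, hp, hq⟩ | ⟨m, hm⟩)
    · rw [child_unique h hp hx, child_unique h hq hy] at hpq
      exact lt_asymm hpq hkl
    · have h1 := child_unique h hm.mem.2 hy
      have h2 := child_unique h hm.mem.1 hx
      exact hkl.ne (h1.symm.trans h2)
  unfold card
  rw [if_neg (by simp [hL, hI]), dif_neg (by simp [hI])]

theorem card_le (t : PlanarTree s) (y x : Fin n) : t.card y x ≤ s y := by
  unfold card
  split_ifs with h1 h2
  · exact Nat.zero_le _
  · exact h2.choose_spec.2.1.le
  · exact le_rfl

/-- Compare the children of the root that contain the labels. Distinct children settle the claim by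
left-right position, and a common child by induction. `card_planar` is the mirror image. -/
theorem card_transitive (t : PlanarTree s) (ht : t.Decreasing) (hn : t.labels.Nodup)
    {x y z : Fin n} (hx : x ∈ t.labels) (hy : y ∈ t.labels) (hz : z ∈ t.labels)
    (hxy : x < y) (hyz : y < z) : t.card y x = 0 ∨ t.card z y ≤ t.card z x := by
  induction t with
  | leaf => simp [labels] at hx
  | node i child ih =>
    have hle := (node i child).card_le z y
    have lti : ∀ {w}, w ∈ (node i child).labels → w ≤ i := by
      intro w hw
      rcases mem_labels_node.1 hw with rfl | ⟨k, hk⟩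
      · exact le_rfl
      · exact ((ht k).1 w hk).le
    obtain ⟨k, hk⟩ := (mem_labels_node.1 hx).resolve_left (hxy.trans (hyz.trans_le (lti hz))).ne
    obtain ⟨l, hl⟩ := (mem_labels_node.1 hy).resolve_left (hyz.trans_le (lti hz)).ne
    rcases lt_trichotomy k l with h | h | h
    · exact Or.inl (card_of_child_lt h hk hl)
    · subst h
      rcases mem_labels_node.1 hz with rfl | ⟨m, hm⟩
      · rw [card_root hn hk, card_root hn hl]
        exact Or.inr le_rfl
      · rcases lt_trichotomy k m with h | h | h
        · rw [card_of_child_lt h hk hm, card_of_child_lt h hl hm]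
          exact Or.inr le_rfl
        · subst h
          rw [card_child hn hk hl, card_child hn hk hm, card_child hn hl hm]
          exact ih k (ht k).2 (nodup_child hn k) hk hl hm
        · rw [card_of_lt_child hn h hk hm, card_of_lt_child hn h hl hm]
          exact Or.inr le_rfl
    · right
      rcases mem_labels_node.1 hz with rfl | ⟨m, hm⟩
      · rw [card_root hn hk, card_root hn hl]
        exact h.le
      · rcases lt_or_ge l m with h' | h'
        · rw [card_of_child_lt h' hl hm]
          exact Nat.zero_le _
        · rwa [card_of_lt_child hn (h'.trans_lt h) hk hm]

theorem card_planar (t : PlanarTree s) (ht : t.Decreasing) (hn : t.labels.Nodup)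
    {x y z : Fin n} (hx : x ∈ t.labels) (hy : y ∈ t.labels) (hz : z ∈ t.labels)
    (hxy : x < y) (hyz : y < z) : t.card y x = s y ∨ t.card z x ≤ t.card z y := by
  induction t with
  | leaf => simp [labels] at hx
  | node i child ih =>
    have hle := (node i child).card_le z x
    have lti : ∀ {w}, w ∈ (node i child).labels → w ≤ i := by
      intro w hw
      rcases mem_labels_node.1 hw with rfl | ⟨k, hk⟩
      · exact le_rfl
      · exact ((ht k).1 w hk).le
    obtain ⟨k, hk⟩ := (mem_labels_node.1 hx).resolve_left (hxy.trans (hyz.trans_le (lti hz))).ne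
    obtain ⟨l, hl⟩ := (mem_labels_node.1 hy).resolve_left (hyz.trans_le (lti hz)).ne
    rcases lt_trichotomy k l with h | h | h
    · right
      rcases mem_labels_node.1 hz with rfl | ⟨m, hm⟩
      · rw [card_root hn hk, card_root hn hl]
        exact h.le
      · rcases lt_or_ge k m with h' | h'
        · rw [card_of_child_lt h' hk hm]
          exact Nat.zero_le _
        · rwa [card_of_lt_child hn (h'.trans_lt h) hl hm]
    · subst h
      rcases mem_labels_node.1 hz with rfl | ⟨m, hm⟩
      · rw [card_root hn hk, card_root hn hl]
        exact Or.inr le_rfl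
      · rcases lt_trichotomy k m with h | h | h
        · rw [card_of_child_lt h hk hm, card_of_child_lt h hl hm]
          exact Or.inr le_rfl
        · subst h
          rw [card_child hn hk hl, card_child hn hk hm, card_child hn hl hm]
          exact ih k (ht k).2 (nodup_child hn k) hk hl hm
        · rw [card_of_lt_child hn h hk hm, card_of_lt_child hn h hl hm]
          exact Or.inr le_rfl
    · exact Or.inl (card_of_lt_child hn h hk hl)

/-- This expresses descent by cardinalities alone: if `x < y` is not below `y`, the vertex where
their paths branch is a label `z > y` that has them in different children, so it tells them apart.
-/
theorem inChild_iff (t : PlanarTree s) (ht : t.Decreasing) (hn : t.labels.Nodup)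
    {x y : Fin n} (hx : x ∈ t.labels) (hy : y ∈ t.labels) (j : ℕ) :
    t.InChild y j x ↔ x < y ∧ t.card y x = j ∧
      ∀ z ∈ t.labels, y < z → t.card z x = t.card z y := by
  induction t with
  | leaf => simp [labels] at hx
  | node i child ih =>
    have lti : ∀ {w}, w ∈ (node i child).labels → w ≤ i := by
      intro w hw
      rcases mem_labels_node.1 hw with rfl | ⟨k, hk⟩
      · exact le_rfl
      · exact ((ht k).1 w hk).le
    rcases mem_labels_node.1 hy with rfl | ⟨l, hl⟩
    · constructor
      · rintro (⟨-, k, rfl, hk⟩ | ⟨k, hk⟩)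
        · exact ⟨(ht k).1 x hk, card_root hn hk, fun z hz hyz => absurd hyz (lti hz).not_gt⟩
        · exact (root_notMem_child hn k hk.mem.1).elim
      · rintro ⟨hxy, rfl, -⟩
        obtain ⟨k, hk⟩ := (mem_labels_node.1 hx).resolve_left hxy.ne
        exact Or.inl ⟨rfl, k, (card_root hn hk).symm, hk⟩
    · have hyi := (ht l).1 y hl
      constructor
      · rintro (⟨rfl, -⟩ | ⟨k, hk⟩)
        · exact (hyi.ne rfl).elim
        · obtain rfl := child_unique hn hk.mem.1 hl
          have hxk := hk.mem.2
          obtain ⟨h1, h2, h3⟩ := (ih k (ht k).2 (nodup_child hn k) hxk hl).1 hk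
          refine ⟨h1, (card_child hn hxk hl).trans h2, fun z hz hyz => ?_⟩
          rcases mem_labels_node.1 hz with rfl | ⟨m, hm⟩
          · rw [card_root hn hxk, card_root hn hl]
          · rcases lt_trichotomy k m with h | h | h
            · rw [card_of_child_lt h hxk hm, card_of_child_lt h hl hm]
            · subst h
              rw [card_child hn hxk hm, card_child hn hl hm]
              exact h3 z hm hyz
            · rw [card_of_lt_child hn h hxk hm, card_of_lt_child hn h hl hm]
      · rintro ⟨hxy, h2, h3⟩
        obtain ⟨k, hk⟩ := (mem_labels_node.1 hx).resolve_left (hxy.trans hyi).ne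
        have h4 := h3 i (mem_labels_node.2 (Or.inl rfl)) hyi
        rw [card_root hn hk, card_root hn hl] at h4
        obtain rfl := Fin.ext h4
        refine Or.inr ⟨k, (ih k (ht k).2 (nodup_child hn k) hk hl).2
          ⟨hxy, (card_child hn hk hl).symm.trans h2, fun z hz hyz => ?_⟩⟩
        rw [← card_child hn hk hz, ← card_child hn hl hz]
        exact h3 z (mem_labels_node.2 (Or.inr ⟨k, hz⟩)) hyz

end PlanarTree

/-! ### Characterization of the inversion functions of trees. -/

/-- Tree inversion sets: multiplicity functions that are bounded by `s`, transitive and planar. -/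
structure IsTreeInversionSet {n : ℕ} (s : Fin n → ℕ) (I : Fin n → Fin n → ℕ) : Prop where
  eq_zero : ∀ y x, ¬ x < y → I y x = 0
  le : ∀ y x, I y x ≤ s y
  transitive : ∀ {x y z}, x < y → y < z → I y x = 0 ∨ I z y ≤ I z x
  planar : ∀ {x y z}, x < y → y < z → I y x = s y ∨ I z x ≤ I z y

/-- The largest label `m` of `A` must be the root, and `x` must go into its child number `I m x`;
recursion builds the children. For `x < y` in different children, transitivity with `m` forces `I y
x = 0` when `x` is on the left, and planarity forces `I y x = s y` when it is on the right. -/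
theorem IsTreeInversionSet.exists_planarTree {n : ℕ} {s : Fin n → ℕ} {I : Fin n → Fin n → ℕ}
    (hI : IsTreeInversionSet s I) (A : Finset (Fin n)) :
    ∃ t : PlanarTree s, t.labels = A.val ∧ t.Decreasing ∧
      ∀ x ∈ A, ∀ y ∈ A, x < y → t.card y x = I y x := by
  induction A using Finset.strongInduction with
  | H A ih =>
    rcases A.eq_empty_or_nonempty with rfl | hA
    · exact ⟨.leaf, rfl, trivial, by simp⟩
    set m := A.max' hA with hm
    have hmA : m ∈ A := A.max'_mem hA
    have hlt : ∀ x ∈ A, x ≠ m → x < m := fun x hx hxm => lt_of_le_of_ne (A.le_max' x hx) hxm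
    let B : Fin (s m + 1) → Finset (Fin n) := fun k => A.filter fun x => x ≠ m ∧ I m x = k
    have hB : ∀ k, B k ⊂ A := fun k =>
      (Finset.ssubset_iff_of_subset (Finset.filter_subset _ _)).2 ⟨m, hmA, by simp⟩
    choose c hc1 hc2 hc3 using fun k => ih (B k) (hB k)
    have hmem : ∀ k x, x ∈ (c k).labels ↔ x ∈ A ∧ x ≠ m ∧ I m x = k := by
      intro k x
      rw [hc1, Finset.mem_val]
      simp [B]
    have hlab : (PlanarTree.node m c).labels = A.val := by
      ext x
      rw [PlanarTree.labels, Multiset.count_cons, Multiset.count_sum']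
      -- Only the child with index `I m x` can contain `x`, so the sum of the counts collapses to
      -- one term.
      have h1 : ∀ k, (c k).labels.count x =
          if k = (⟨I m x, Nat.lt_succ_of_le (hI.le m x)⟩ : Fin (s m + 1)) then
            (if x ∈ A ∧ x ≠ m then 1 else 0) else 0 := by
        intro k
        rw [hc1, Multiset.count_eq_of_nodup (B k).nodup]
        simp only [Finset.mem_val, B, Finset.mem_filter, Fin.ext_iff]
        split_ifs <;> first | rfl | (exfalso; grind)
      simp only [h1, Finset.sum_ite_eq', Finset.mem_univ, if_true]
      rw [Multiset.count_eq_of_nodup A.nodup]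
      simp only [Finset.mem_val]
      by_cases hxm : x = m
      · subst hxm
        simp [hmA]
      · simp [hxm]
    have hnd : (PlanarTree.node m c).labels.Nodup := hlab ▸ A.nodup
    refine ⟨.node m c, hlab, fun k => ⟨fun x hx => ?_, hc2 k⟩, fun x hx y hy hxy => ?_⟩
    · have := (hmem k x).1 hx
      exact hlt x this.1 this.2.1
    · have hxm : x ≠ m := (hxy.trans_le (A.le_max' y hy)).ne
      let pos : Fin n → Fin (s m + 1) := fun x => ⟨I m x, Nat.lt_succ_of_le (hI.le m x)⟩
      have hxc : x ∈ (c (pos x)).labels := (hmem _ _).2 ⟨hx, hxm, rfl⟩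
      by_cases hym : y = m
      · rw [hym]
        exact PlanarTree.card_root hnd hxc
      · have hyc : y ∈ (c (pos y)).labels := (hmem _ _).2 ⟨hy, hym, rfl⟩
        have hyltm := hlt y hy hym
        rcases lt_trichotomy (pos x) (pos y) with h | h | h
        · rw [PlanarTree.card_of_child_lt h hxc hyc]
          exact ((hI.transitive hxy hyltm).resolve_right (not_le.2 h)).symm
        · rw [← h] at hyc
          rw [PlanarTree.card_child hnd hxc hyc]
          rw [hc1, Finset.mem_val] at hxc hyc
          exact hc3 _ x hxc y hyc hxy
        · rw [PlanarTree.card_of_lt_child hnd h hxc hyc]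
          exact ((hI.planar hxy hyltm).resolve_right (not_le.2 h)).symm

namespace SDecreasingTree

variable {n : ℕ} {s : Fin n → ℕ}

theorem mem_labels (T : SDecreasingTree s) (x : Fin n) : x ∈ T.tree.labels := by
  rw [T.labels_eq]
  exact Finset.mem_univ x

theorem nodup_labels (T : SDecreasingTree s) : T.tree.labels.Nodup := by
  rw [T.labels_eq]
  exact Finset.univ.nodup

theorem inv_mult_of_lt (T : SDecreasingTree s) {y x : Fin n} (h : x < y) :
    T.inv.mult y x = T.tree.card y x := if_pos h

theorem isTreeInversionSet_inv (T : SDecreasingTree s) : IsTreeInversionSet s T.inv.mult where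
  eq_zero := T.inv.mult_eq_zero
  le y x := by
    by_cases h : x < y
    · rw [T.inv_mult_of_lt h]
      exact T.tree.card_le y x
    · rw [T.inv.mult_eq_zero y x h]
      exact Nat.zero_le _
  transitive {x y z} hxy hyz := by
    rw [T.inv_mult_of_lt hxy, T.inv_mult_of_lt hyz, T.inv_mult_of_lt (hxy.trans hyz)]
    exact T.tree.card_transitive T.decreasing T.nodup_labels (T.mem_labels x) (T.mem_labels y)
      (T.mem_labels z) hxy hyz
  planar {x y z} hxy hyz := by
    rw [T.inv_mult_of_lt hxy, T.inv_mult_of_lt hyz, T.inv_mult_of_lt (hxy.trans hyz)]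
    exact T.tree.card_planar T.decreasing T.nodup_labels (T.mem_labels x) (T.mem_labels y)
      (T.mem_labels z) hxy hyz

theorem inChild_iff (T : SDecreasingTree s) {x y : Fin n} (j : ℕ) :
    T.tree.InChild y j x ↔ x < y ∧ T.inv.mult y x = j ∧
      ∀ z, y < z → T.inv.mult z x = T.inv.mult z y := by
  rw [T.tree.inChild_iff T.decreasing T.nodup_labels (T.mem_labels x) (T.mem_labels y)]
  refine and_congr_right fun hxy => ?_
  rw [T.inv_mult_of_lt hxy]
  refine and_congr_right fun _ => forall_congr' fun z => ?_
  constructor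
  · intro h hyz
    rw [T.inv_mult_of_lt hyz, T.inv_mult_of_lt (hxy.trans hyz)]
    exact h (T.mem_labels z) hyz
  · intro h _ hyz
    rw [← T.inv_mult_of_lt hyz, ← T.inv_mult_of_lt (hxy.trans hyz)]
    exact h hyz

theorem exists_inv_mult_eq {I : Fin n → Fin n → ℕ} (hI : IsTreeInversionSet s I) :
    ∃ T : SDecreasingTree s, T.inv.mult = I := by
  obtain ⟨t, h1, h2, h3⟩ := hI.exists_planarTree Finset.univ
  refine ⟨⟨t, h1, h2⟩, funext fun y => funext fun x => ?_⟩
  by_cases h : x < y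
  · rw [inv_mult_of_lt _ h]
    exact h3 x (Finset.mem_univ _) y (Finset.mem_univ _) h
  · rw [hI.eq_zero y x h]
    exact MultiInversionSet.mult_eq_zero _ y x h

theorem le_iff {T Z : SDecreasingTree s} : T ≤ Z ↔ ∀ y x, T.inv.mult y x ≤ Z.inv.mult y x :=
  Iff.rfl

theorem eq_of_mult_eq {T Z : SDecreasingTree s} (h : T.inv.mult = Z.inv.mult) : T = Z :=
  inv_injective (MultiInversionSet.ext h)

instance : Finite (SDecreasingTree s) := by
  let f : SDecreasingTree s → (y : Fin n) → Fin n → Fin (s y + 1) := fun T y x =>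
    ⟨T.inv.mult y x, Nat.lt_succ_of_le (T.isTreeInversionSet_inv.le y x)⟩
  refine Finite.of_injective f fun T Z h => eq_of_mult_eq (funext fun y => funext fun x => ?_)
  exact congrArg Fin.val (congrFun (congrFun h y) x)

end SDecreasingTree

theorem Fin.exists_greatest {n : ℕ} {P : Fin n → Prop} (h : ∃ x, P x) :
    ∃ x, P x ∧ ∀ y, x < y → ¬ P y := by
  classical
  obtain ⟨x, hx⟩ := h
  obtain ⟨m, hm, hmax⟩ := Finset.exists_max_image (Finset.univ.filter P) id ⟨x, by simp [hx]⟩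
  simp only [Finset.mem_filter, Finset.mem_univ, true_and, id] at hm hmax
  exact ⟨m, hm, fun y hy hPy => (hmax y hPy).not_gt hy⟩

theorem Fin.exists_least {n : ℕ} {P : Fin n → Prop} (h : ∃ x, P x) :
    ∃ x, P x ∧ ∀ y, y < x → ¬ P y := by
  classical
  obtain ⟨x, hx⟩ := h
  obtain ⟨m, hm, hmin⟩ := Finset.exists_min_image (Finset.univ.filter P) id ⟨x, by simp [hx]⟩
  simp only [Finset.mem_filter, Finset.mem_univ, true_and, id] at hm hmin
  exact ⟨m, hm, fun y hy hPy => (hmin y hPy).not_gt hy⟩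

/-! ### Transitive closure and the lattice property. -/

open Classical in
/-- The transitive closure of a multiplicity function. -/
noncomputable def transitiveClosure {n : ℕ} (I : Fin n → Fin n → ℕ) (z x : Fin n) : ℕ :=
  (Finset.univ.filter fun d =>
    d < z ∧ Relation.ReflTransGen (fun p q => q < p ∧ 0 < I p q) d x).sup (I z)

section closure

variable {n : ℕ} {s : Fin n → ℕ} {I J : Fin n → Fin n → ℕ}

theorem le_transitiveClosure_of_reach {z d x : Fin n} (hd : d < z)
    (h : Relation.ReflTransGen (fun p q => q < p ∧ 0 < I p q) d x) :
    I z d ≤ transitiveClosure I z x :=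
  Finset.le_sup (f := I z) (by simp [hd, h])

theorem le_transitiveClosure (h0 : ∀ y x, ¬ x < y → I y x = 0) (z x : Fin n) :
    I z x ≤ transitiveClosure I z x := by
  by_cases h : x < z
  · exact le_transitiveClosure_of_reach h .refl
  · rw [h0 z x h]
    exact Nat.zero_le _

theorem exists_transitiveClosure_eq {z x : Fin n} (h : 0 < transitiveClosure I z x) :
    ∃ d < z, Relation.ReflTransGen (fun p q => q < p ∧ 0 < I p q) d x ∧
      transitiveClosure I z x = I z d := by
  classical
  by_cases hne : (Finset.univ.filter fun d =>
    d < z ∧ Relation.ReflTransGen (fun p q => q < p ∧ 0 < I p q) d x).Nonempty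
  · obtain ⟨d, hd, hd'⟩ := Finset.exists_mem_eq_sup _ hne (I z)
    simp only [Finset.mem_filter, Finset.mem_univ, true_and] at hd
    refine ⟨d, hd.1, hd.2, ?_⟩
    rw [← hd', transitiveClosure]
  · rw [Finset.not_nonempty_iff_eq_empty] at hne
    have : transitiveClosure I z x = 0 := by
      rw [transitiveClosure, hne]
      rfl
    omega

theorem le_of_reach {d x : Fin n}
    (h : Relation.ReflTransGen (fun p q => q < p ∧ 0 < I p q) d x) : x ≤ d := by
  induction h with
  | refl => exact le_rfl
  | tail _ h ih => exact h.1.le.trans ih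

theorem transitiveClosure_transitive {x y z : Fin n} :
    transitiveClosure I y x = 0 ∨ transitiveClosure I z y ≤ transitiveClosure I z x := by
  rcases Nat.eq_zero_or_pos (transitiveClosure I y x) with h | h
  · exact Or.inl h
  right
  obtain ⟨e, hey, he, he'⟩ := exists_transitiveClosure_eq h
  rcases Nat.eq_zero_or_pos (transitiveClosure I z y) with h1 | h1
  · omega
  obtain ⟨d, hdz, hd, hd'⟩ := exists_transitiveClosure_eq h1
  rw [hd']
  refine le_transitiveClosure_of_reach hdz (hd.trans ?_)
  exact .head ⟨hey, by omega⟩ he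

/-- A descending chain from `d ≥ y` to `x < y` either visits `y` or contains one step `p → q` that
jumps over it. -/
theorem exists_reach_or_crossing {d x y : Fin n}
    (h : Relation.ReflTransGen (fun p q => q < p ∧ 0 < I p q) d x) (hyd : y ≤ d) (hxy : x < y) :
    Relation.ReflTransGen (fun p q => q < p ∧ 0 < I p q) d y ∨
      ∃ p q, Relation.ReflTransGen (fun p q => q < p ∧ 0 < I p q) d p ∧ y < p ∧ q < y ∧
        0 < I p q ∧ Relation.ReflTransGen (fun p q => q < p ∧ 0 < I p q) q x := by
  induction h with
  | refl => exact absurd hxy hyd.not_gt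
  | @tail b c hb hc ih =>
    rcases lt_trichotomy b y with h | h | h
    · rcases ih h with h1 | ⟨p, q, h1, h2, h3, h4, h5⟩
      · exact Or.inl h1
      · exact Or.inr ⟨p, q, h1, h2, h3, h4, h5.tail hc⟩
    · exact Or.inl (h ▸ hb)
    · exact Or.inr ⟨b, c, hb, h, hxy, hc.2, .refl⟩

/-- Planarity survives the closure. Let `I z d` be the value of the closure at `(z, x)`. If `d < y`,
planarity of `I` at `d < y < z` suffices. Otherwise the chain from `d` to `x` visits `y`, or it
jumps over `y` by `p → q`; then planarity at `q < y < p` either gives `I y q = s y`, which passes on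
to `x`, or makes `I p y` positive, which diverts the chain to `y`. -/
theorem isTreeInversionSet_transitiveClosure (h0 : ∀ y x, ¬ x < y → I y x = 0)
    (hle : ∀ y x, I y x ≤ s y)
    (hp : ∀ {x y z}, x < y → y < z → I y x = s y ∨ I z x ≤ I z y) :
    IsTreeInversionSet s (transitiveClosure I) := by
  have hle' : ∀ y x, transitiveClosure I y x ≤ s y := fun y x => Finset.sup_le fun d _ => hle y d
  have key : ∀ {x y d : Fin n}, d < y →
      Relation.ReflTransGen (fun p q => q < p ∧ 0 < I p q) d x → I y d = s y →
      transitiveClosure I y x = s y := by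
    intro x y d hdy hd h
    refine le_antisymm (hle' y x) ?_
    rw [← h]
    exact le_transitiveClosure_of_reach hdy hd
  refine ⟨fun y x hxy => ?_, hle', fun _ _ => transitiveClosure_transitive, ?_⟩
  · by_contra h
    obtain ⟨d, hd, hd', -⟩ := exists_transitiveClosure_eq (Nat.pos_of_ne_zero h)
    exact hxy ((le_of_reach hd').trans_lt hd)
  · intro x y z hxy hyz
    rcases Nat.eq_zero_or_pos (transitiveClosure I z x) with h | h
    · omega
    obtain ⟨d, hdz, hd, hd'⟩ := exists_transitiveClosure_eq h
    rw [hd']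
    rcases lt_or_ge d y with hdy | hdy
    · rcases hp hdy hyz with h1 | h1
      · exact Or.inl (key hdy hd h1)
      · exact Or.inr (h1.trans (le_transitiveClosure h0 z y))
    · rcases exists_reach_or_crossing hd hdy hxy with h1 | ⟨p, q, h1, h2, h3, h4, h5⟩
      · exact Or.inr (le_transitiveClosure_of_reach hdz h1)
      · rcases hp h3 h2 with h6 | h6
        · exact Or.inl (key h3 h5 h6)
        · exact Or.inr (le_transitiveClosure_of_reach hdz (h1.tail ⟨h2, by omega⟩))

theorem transitiveClosure_le
    (hJ : ∀ {x y z}, x < y → y < z → J y x = 0 ∨ J z y ≤ J z x) (hIJ : ∀ y x, I y x ≤ J y x)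
    (z x : Fin n) : transitiveClosure I z x ≤ J z x := by
  refine Finset.sup_le fun d hd => ?_
  simp only [Finset.mem_filter, Finset.mem_univ, true_and] at hd
  obtain ⟨hdz, hd⟩ := hd
  refine (hIJ z d).trans ?_
  induction hd with
  | refl => exact le_rfl
  | @tail b c hb hc ih =>
    have h1 := hIJ b c
    exact ih.trans ((hJ hc.1 ((le_of_reach hb).trans_lt hdz)).resolve_left (by omega))

end closure

namespace SDecreasingTree

variable {n : ℕ} {s : Fin n → ℕ}

theorem exists_isLUB_pair (T Z : SDecreasingTree s) : ∃ J, IsLUB {T, Z} J := by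
  have hT := T.isTreeInversionSet_inv
  have hZ := Z.isTreeInversionSet_inv
  let I : Fin n → Fin n → ℕ := fun y x => max (T.inv.mult y x) (Z.inv.mult y x)
  have h0 : ∀ y x, ¬ x < y → I y x = 0 := fun y x h => by
    simp [I, hT.eq_zero y x h, hZ.eq_zero y x h]
  have hI : IsTreeInversionSet s (transitiveClosure I) := by
    refine isTreeInversionSet_transitiveClosure h0
      (fun y x => max_le (hT.le y x) (hZ.le y x)) fun {x y z} hxy hyz => ?_
    have h1 := hT.planar hxy hyz
    have h2 := hZ.planar hxy hyz
    have h3 := hT.le y x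
    have h4 := hZ.le y x
    simp only [I]
    omega
  obtain ⟨J, hJ⟩ := exists_inv_mult_eq hI
  refine ⟨J, ?_, ?_⟩
  · have h1 := le_transitiveClosure h0
    rintro L (rfl | rfl)
    · exact fun y x => hJ ▸ (le_max_left _ _).trans (h1 y x)
    · exact fun y x => hJ ▸ (le_max_right _ _).trans (h1 y x)
  · intro L hL y x
    rw [hJ]
    exact transitiveClosure_le L.isTreeInversionSet_inv.transitive
      (fun y x => max_le (hL (Or.inl rfl) y x) (hL (Or.inr rfl) y x)) y x

theorem exists_isBot : ∃ B : SDecreasingTree s, ∀ T, B ≤ T := by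
  obtain ⟨B, hB⟩ := exists_inv_mult_eq (s := s) (I := fun _ _ => 0)
    ⟨fun _ _ _ => rfl, fun _ _ => Nat.zero_le _, fun _ _ => Or.inl rfl, fun _ _ => Or.inr le_rfl⟩
  exact ⟨B, fun T y x => by rw [hB]; exact Nat.zero_le _⟩

end SDecreasingTree

/-- The meet is the join of all common lower bounds; the bottom element is the join of the empty
set. -/
theorem exists_isGLB_pair_of_finite {P : Type*} [PartialOrder P] [Finite P]
    (hbot : ∃ b : P, ∀ x, b ≤ x) (h : ∀ x y : P, ∃ j, IsLUB {x, y} j) (x y : P) :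
    ∃ m, IsGLB {x, y} m := by
  have key : ∀ S : Set P, S.Finite → ∃ j, IsLUB S j := by
    intro S hS
    induction S, hS using Set.Finite.induction_on with
    | empty =>
      obtain ⟨b, hb⟩ := hbot
      exact ⟨b, isLUB_empty_iff.2 hb⟩
    | @insert a S _ _ ih =>
      obtain ⟨j, hj⟩ := ih
      obtain ⟨k, hk⟩ := h a j
      refine ⟨k, ?_, fun u hu => hk.2 ?_⟩
      · rintro z (rfl | hz)
        · exact hk.1 (Or.inl rfl)
        · exact (hj.1 hz).trans (hk.1 (Or.inr rfl))
      · rintro z (rfl | rfl)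
        · exact hu (Or.inl rfl)
        · exact hj.2 fun w hw => hu (Or.inr hw)
  obtain ⟨m, hm⟩ := key (lowerBounds {x, y}) (Set.toFinite _)
  exact ⟨m, fun z hz => hm.2 fun w hw => hw hz, fun w hw => hm.1 hw⟩

/-! ### Ascents and rotations of multiplicity functions. -/

/-- The pair `(a, b)` is an ascent of the multiplicity function `I`. -/
structure IsAscent {n : ℕ} (s : Fin n → ℕ) (I : Fin n → Fin n → ℕ) (a b : Fin n) : Prop where
  lt : a < b
  lt_bound : I b a < s b
  above : ∀ z, b < z → I z a = I z b
  between : ∀ e, a < e → e < b → I b e = I b a → I e a = s e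
  below : ∀ x, x < a → I b x = I b a → 0 < I a x → I a x < s a

/-- The rotation along `(a, b)` increases the multiplicity of `(b, x)` for these labels `x`. -/
def Moves {n : ℕ} (I : Fin n → Fin n → ℕ) (a b x : Fin n) : Prop :=
  x = a ∨ x < a ∧ 0 < I a x ∧ I b x = I b a

open Classical in
/-- The multiplicity function of the rotation along `(a, b)`. -/
noncomputable def rotate {n : ℕ} (I : Fin n → Fin n → ℕ) (a b y x : Fin n) : ℕ :=
  I y x + if y = b ∧ Moves I a b x then 1 else 0

section ascent

variable {n : ℕ} {s : Fin n → ℕ} {I J : Fin n → Fin n → ℕ} {a b : Fin n}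

theorem rotate_of_moves {x : Fin n} (h : Moves I a b x) : rotate I a b b x = I b x + 1 := by
  simp [rotate, h]

theorem rotate_of_ne {y x : Fin n} (h : y ≠ b) : rotate I a b y x = I y x := by
  simp [rotate, h]

theorem rotate_of_not_moves {y x : Fin n} (h : ¬ Moves I a b x) : rotate I a b y x = I y x := by
  simp [rotate, h]

theorem le_rotate (y x : Fin n) : I y x ≤ rotate I a b y x := Nat.le_add_right _ _

theorem rotate_le (y x : Fin n) : rotate I a b y x ≤ I y x + 1 := by
  unfold rotate
  split_ifs <;> omega

theorem lt_rotate_iff {y x : Fin n} : I y x < rotate I a b y x ↔ y = b ∧ Moves I a b x := by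
  unfold rotate
  split_ifs with h <;> simp [h]

theorem Moves.le {x : Fin n} (h : Moves I a b x) : x ≤ a := by
  rcases h with rfl | h
  · exact le_rfl
  · exact h.1.le

theorem Moves.mult_eq {x : Fin n} (h : Moves I a b x) : I b x = I b a := by
  rcases h with rfl | h
  · rfl
  · exact h.2.2

theorem Moves.mult_lt (h : IsAscent s I a b) {x : Fin n}
    (hx : Moves I a b x) : I b x < s b := by
  rw [hx.mult_eq]
  exact h.lt_bound

theorem Moves.mult_le (hI : IsTreeInversionSet s I) {x z : Fin n} (h : Moves I a b x)
    (hz : a < z) : I z a ≤ I z x := by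
  rcases h with rfl | h
  · exact le_rfl
  · exact (hI.transitive h.1 hz).resolve_left h.2.1.ne'

theorem Moves.trans (hI : IsTreeInversionSet s I) (hab : a < b) {x y : Fin n}
    (h : Moves I a b y) (hxy : x < y) (hx : 0 < I y x) (hb : I b x = I b y) :
    Moves I a b x := by
  rcases h with rfl | h
  · exact Or.inr ⟨hxy, hx, hb⟩
  · have := (hI.transitive hxy h.1).resolve_left hx.ne'
    exact Or.inr ⟨hxy.trans h.1, by omega, hb.trans h.2.2⟩

/-- Transitivity holds because the moved labels are closed under `Moves.trans`. Planarity is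
delicate only for `x < y < b` where `x` moves, `y` does not, and `I b x = I b y`; one then needs `I
y x = s y`. If `y < a`, then `I a y = 0` while `I a x > 0`, and planarity below `a` applies. If `y >
a`, the ascent gives `I y a = s y`, and `I y a ≤ I y x`. -/
theorem IsAscent.isTreeInversionSet_rotate (hI : IsTreeInversionSet s I) (h : IsAscent s I a b) :
    IsTreeInversionSet s (rotate I a b) where
  eq_zero y x hxy := by
    have h1 : ¬ (y = b ∧ Moves I a b x) := by
      rintro ⟨rfl, hx⟩
      exact hxy (hx.le.trans_lt h.lt)
    rw [rotate, if_neg h1, hI.eq_zero y x hxy]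
  le y x := by
    unfold rotate
    split_ifs with h1
    · obtain ⟨rfl, h1⟩ := h1
      exact h1.mult_lt h
    · exact hI.le y x
  transitive {x y z} hxy hyz := by
    by_cases h1 : I y x < rotate I a b y x
    · obtain ⟨rfl, hx⟩ := lt_rotate_iff.1 h1
      right
      rw [rotate_of_ne hyz.ne', rotate_of_ne hyz.ne', ← h.above z hyz]
      exact hx.mult_le hI (h.lt.trans hyz)
    have h2 := hI.transitive hxy hyz
    have h3 := le_rotate (I := I) (a := a) (b := b) y x
    have h4 := le_rotate (I := I) (a := a) (b := b) z x
    by_cases h5 : I z y < rotate I a b z y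
    · obtain ⟨rfl, hy⟩ := lt_rotate_iff.1 h5
      have h6 := rotate_of_moves hy
      by_cases h7 : 0 < I y x
      · by_cases h8 : I z x = I z y
        · have := rotate_of_moves (hy.trans hI h.lt hxy h7 h8)
          omega
        · omega
      · omega
    · omega
  planar {x y z} hxy hyz := by
    have h2 := hI.planar hxy hyz
    have h3 := le_rotate (I := I) (a := a) (b := b) z y
    by_cases h1 : I y x < rotate I a b y x
    · obtain ⟨rfl, hx⟩ := lt_rotate_iff.1 h1
      have := hx.mult_lt h
      rw [rotate_of_ne hyz.ne', rotate_of_ne hyz.ne']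
      omega
    have h4 := le_rotate (I := I) (a := a) (b := b) y x
    by_cases h5 : I z x < rotate I a b z x
    · obtain ⟨rfl, hx⟩ := lt_rotate_iff.1 h5
      have h6 := rotate_of_moves hx
      by_cases hy : Moves I a z y
      · have := rotate_of_moves hy
        have := hx.mult_eq
        have := hy.mult_eq
        omega
      by_cases h7 : I z y = I z x
      · left
        have h8 : y ≠ a := fun e => hy (Or.inl e)
        suffices I y x = s y by omega
        rcases lt_or_gt_of_ne h8 with h9 | h9
        · have hyx := hx.mult_eq
          have h10 : I a y = 0 := by
            by_contra h0
            exact hy (Or.inr ⟨h9, Nat.pos_of_ne_zero h0, h7.trans hyx⟩)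
          rcases hx with rfl | hx
          · exact absurd hxy h9.not_gt
          · have := hI.planar hxy h9
            have := hx.2.1
            omega
        · have h10 := h.between y h9 hyz (h7.trans hx.mult_eq)
          have := hx.mult_le hI h9
          have := hI.le y x
          omega
      · omega
    · omega

theorem rotate_le_of_le
    (hJ : ∀ {x y z}, x < y → y < z → J y x = 0 ∨ J z y ≤ J z x) (hIJ : ∀ y x, I y x ≤ J y x)
    (hab : a < b) (h : I b a < J b a) (y x : Fin n) : rotate I a b y x ≤ J y x := by
  by_cases h1 : I y x < rotate I a b y x
  · obtain ⟨rfl, hx⟩ := lt_rotate_iff.1 h1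
    rw [rotate_of_moves hx]
    rcases hx with rfl | hx
    · exact h
    · have := (hJ hx.1 hab).resolve_left (hx.2.1.trans_le (hIJ a x)).ne'
      omega
  · exact (not_lt.1 h1).trans (hIJ y x)

/-- Incomparable vertices `x < e` have a lowest common ancestor. -/
theorem IsTreeInversionSet.exists_common_ancestor (hI : IsTreeInversionSet s I) {x e : Fin n}
    (hx : x < e) (hxe : ¬ ∀ z, e < z → I z x = I z e) :
    ∃ z, e < z ∧ I z x ≠ I z e ∧ ∀ w, z < w → I w x = I w z := by
  push Not at hxe
  obtain ⟨z, ⟨hz, hne⟩, hmax⟩ := Fin.exists_greatest hxe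
  refine ⟨z, hz, hne, fun w hw => ?_⟩
  have h1 : I w x = I w e := by
    by_contra h
    exact hmax w hw ⟨hz.trans hw, h⟩
  have h2 := hI.transitive hz hw
  have h3 := hI.planar hz hw
  have h4 := hI.transitive (hx.trans hz) hw
  have h5 := hI.planar (hx.trans hz) hw
  omega

/-- A tree ascent constrains only the ancestors `e` of `a`, whereas `IsAscent` constrains all `e`
with `I b e = I b a`. For `e` not an ancestor, the lowest common ancestor `z` of `a` and `e` carries
the information: if `z < b`, then `a` is in the last subtree of `z`, hence right of `e`. -/
theorem IsTreeInversionSet.between_of_ancestors (hI : IsTreeInversionSet s I)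
    (hlt : I b a < s b) (habove : ∀ z, b < z → I z a = I z b)
    (h : ∀ e, a < e → e < b → (∀ z, e < z → I z a = I z e) → I e a = s e)
    (e : Fin n) (hae : a < e) (heb : e < b) (hb : I b e = I b a) : I e a = s e := by
  by_cases hd : ∀ z, e < z → I z a = I z e
  · exact h e hae heb hd
  obtain ⟨z, hz, hne, hzw⟩ := hI.exists_common_ancestor hae hd
  have hle := hI.le z e
  have h1 := hI.transitive hae hz
  have h2 := hI.planar hae hz
  rcases lt_trichotomy z b with hzb | rfl | hbz
  · have := h z (hae.trans hz) hzb hzw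
    omega
  · exact absurd hb.symm hne
  · have h3 := habove z hbz
    have h4 := hI.transitive heb hbz
    have h5 := hI.planar heb hbz
    omega

/-- If `I a x = s a` with `s a > 0`, the other ascent conditions force `I z x = I z a` for all `z >
a`. Then `x` is a descendant in the last subtree of `a`, which is a leaf. -/
theorem IsTreeInversionSet.below_of_isLeaf (hI : IsTreeInversionSet s I) (hab : a < b)
    (hlt : I b a < s b) (habove : ∀ z, b < z → I z a = I z b)
    (hbetween : ∀ e, a < e → e < b → I b e = I b a → I e a = s e)
    (h : 0 < s a → ∀ x, ¬ (x < a ∧ I a x = s a ∧ ∀ z, a < z → I z x = I z a))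
    (x : Fin n) (hxa : x < a) (hb : I b x = I b a) (hpos : 0 < I a x) : I a x < s a := by
  by_contra hge
  have hle := hI.le a x
  have hs : I a x = s a := by omega
  refine h (by omega) x ⟨hxa, hs, fun z hz => ?_⟩
  have h1 := (hI.transitive hxa hz).resolve_left hpos.ne'
  rcases lt_trichotomy z b with hzb | rfl | hbz
  · by_contra hne
    have h2 := hbetween z hz hzb
    have h3 := hI.le z x
    have h4 := hI.planar hz hzb
    have h5 := hI.transitive (hxa.trans hz) hzb
    omega
  · exact hb
  · have h2 := habove z hbz
    have h3 := hI.planar (hxa.trans hab) hbz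
    omega

/-- If `I` is strictly below `J`, then `I` has an ascent whose rotation is below `J`. -/
theorem IsTreeInversionSet.exists_isAscent (hI : IsTreeInversionSet s I)
    (hJ : IsTreeInversionSet s J) (hIJ : ∀ y x, I y x ≤ J y x) (hne : I ≠ J) :
    ∃ a b, IsAscent s I a b ∧ I b a < J b a := by
  have hex : ∃ y x, I y x < J y x := by
    by_contra h
    push Not at h
    exact hne (funext fun y => funext fun x => le_antisymm (hIJ y x) (h y x))
  obtain ⟨y, hy, hmax⟩ := Fin.exists_greatest hex
  have heq : ∀ z, y < z → ∀ x, I z x = J z x := fun z hz x => by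
    by_contra h
    exact hmax z hz ⟨x, lt_of_le_of_ne (hIJ z x) h⟩
  have hlt : ∀ {y x}, I y x < J y x → x < y := fun {y x} h => by
    by_contra h0
    rw [hJ.eq_zero y x h0] at h
    exact absurd h (Nat.not_lt_zero _)
  -- Here `I y x < s y` makes planarity of `I` usable and `J y x > 0` makes transitivity of `J`
  -- usable; the rows above `y` agree, so the two inequalities combine.
  have hdesc : ∀ x, I y x < J y x → ∀ z, y < z → I z x = I z y := by
    intro x hx z hz
    have h1 := hI.planar (hlt hx) hz
    have h2 := hJ.transitive (hlt hx) hz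
    have h3 := hJ.le y x
    rw [← heq z hz, ← heq z hz] at h2
    omega
  -- All ascent conditions except the leaf condition. Take `a` largest with a deficit in row `y`,
  -- and then `b` least among the ancestors of `a` with a deficit at `a`. An ancestor `e` of `a`
  -- violating the condition would itself have a deficit in row `y`, against the choice of `a`.
  have step : ∃ a b, a < b ∧ I b a < J b a ∧ (∀ z, b < z → I z a = I z b) ∧
      ∀ e, a < e → e < b → (∀ z, e < z → I z a = I z e) → I e a = s e := by
    obtain ⟨a, ha, hamax⟩ := Fin.exists_greatest hy
    obtain ⟨b, ⟨hb, hbd⟩, hbmin⟩ := Fin.exists_least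
      (P := fun b => I b a < J b a ∧ ∀ z, b < z → I z a = I z b) ⟨y, ha, hdesc a ha⟩
    have hby : b ≤ y := not_lt.1 fun h => hmax b h ⟨a, hb⟩
    refine ⟨a, b, hlt hb, hb, hbd, fun e hae heb hed => ?_⟩
    by_contra hes
    have hey := heb.trans_le hby
    have h1 : I e a = J e a := by
      by_contra h
      exact hbmin e heb ⟨lt_of_le_of_ne (hIJ e a) h, hed⟩
    have h2 := (hJ.planar hae hey).resolve_left (h1 ▸ hes)
    have h3 := hed y hey
    exact hamax e hae (by omega)
  obtain ⟨a, ⟨b, hab, h1, h2, h3⟩, hmin⟩ := Fin.exists_least step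
  have hlts : I b a < s b := h1.trans_le (hJ.le b a)
  have hbetween := hI.between_of_ancestors hlts h2 h3
  refine ⟨a, b, ⟨hab, hlts, h2, hbetween, ?_⟩, h1⟩
  refine hI.below_of_isLeaf hab hlts h2 hbetween fun hs x hx => ?_
  -- If the last subtree of `a` is not a leaf, its largest label `v` satisfies the same conditions
  -- with the same `b`, against the minimality of `a`.
  obtain ⟨v, ⟨hva, hvs, hvd⟩, hvmax⟩ := Fin.exists_greatest
    (P := fun x => x < a ∧ I a x = s a ∧ ∀ z, a < z → I z x = I z a) ⟨x, hx⟩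
  have hJv := (hJ.transitive hva hab).resolve_left (by have := hIJ a v; omega)
  have hbv := hvd b hab
  refine hmin v hva ⟨b, hva.trans hab, by omega, fun z hz => ?_, fun e hve heb hed => ?_⟩
  · rw [hvd z (hab.trans hz), h2 z hz]
  · rcases lt_trichotomy e a with hea | rfl | hae
    · have hed' : ∀ z, a < z → I z e = I z a := fun z hz => by
        rw [← hed z (hea.trans hz), hvd z hz]
      exact absurd ⟨hea, by rw [← hed a hea, hvs], hed'⟩ (hvmax e hve)
    · exact hvs
    · rw [hvd e hae]
      exact h3 e hae heb fun z hz => by rw [← hvd z (hae.trans hz), hed z hz]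

end ascent

namespace SDecreasingTree

variable {n : ℕ} {s : Fin n → ℕ}

theorem isTreeAscent_iff {T : SDecreasingTree s} {a b : Fin n} :
    T.IsTreeAscent a b ↔ IsAscent s T.inv.mult a b := by
  have hI := T.isTreeInversionSet_inv
  constructor
  · rintro ⟨hab, ⟨i, hi, hi'⟩, h2, h3⟩
    obtain ⟨-, rfl, habove⟩ := T.inChild_iff _ |>.1 hi'
    have hbetween := hI.between_of_ancestors hi habove fun e hae heb hd =>
      h2 e hae heb _ ((T.inChild_iff _).2 ⟨hae, rfl, hd⟩)
    refine ⟨hab, hi, habove, hbetween, hI.below_of_isLeaf hab hi habove hbetween ?_⟩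
    exact fun hs x hx => h3 hs x ((T.inChild_iff _).2 hx)
  · intro h
    refine ⟨h.lt, ⟨_, h.lt_bound, (T.inChild_iff _).2 ⟨h.lt, rfl, h.above⟩⟩, ?_, ?_⟩
    · intro e hae heb j hj
      obtain ⟨-, rfl, hd⟩ := (T.inChild_iff _).1 hj
      exact h.between e hae heb (hd b heb).symm
    · intro hs x hx
      obtain ⟨hxa, hxs, hd⟩ := (T.inChild_iff _).1 hx
      exact (h.below x hxa (hd b h.lt) (by omega)).ne hxs

/-- `rotate` is itself transitive, and every transitive set above `I` that is larger at `(b, a)`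
contains it. The cap at `s b` has no effect at `(b, a)`, since `I b a < s b`. -/
theorem isRotation_iff {T Z : SDecreasingTree s} {a b : Fin n} :
    IsRotation T Z a b ↔
      IsAscent s T.inv.mult a b ∧ Z.inv.mult = rotate T.inv.mult a b := by
  rw [IsRotation, isTreeAscent_iff]
  refine and_congr_right fun h => ?_
  have hI := T.isTreeInversionSet_inv
  obtain ⟨R, hR⟩ := exists_inv_mult_eq (h.isTreeInversionSet_rotate hI)
  have hleast : (T.inv.addPair s b a).IsTransitiveClosure R.inv := by
    refine ⟨⟨fun x y z => R.isTreeInversionSet_inv.transitive, fun y x => ?_⟩, ?_⟩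
    · rw [hR]
      simp only [MultiInversionSet.addPair]
      split_ifs with h1 h2
      · obtain ⟨rfl, rfl⟩ := h2
        rw [rotate_of_moves (Or.inl rfl)]
        exact min_le_left _ _
      · exact (min_le_left _ _).trans (le_rotate (I := T.inv.mult) y x)
      · exact Nat.zero_le _
    · rintro J ⟨hJ, hle⟩
      have hTJ : ∀ y x, T.inv.mult y x ≤ J.mult y x := fun y x => by
        refine le_trans ?_ (hle y x)
        simp only [MultiInversionSet.addPair]
        split_ifs with h1
        · exact le_min (Nat.le_add_right _ _) (hI.le y x)
        · exact le_min (Nat.le_add_right _ _) (hI.le y x)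
        · rw [hI.eq_zero y x h1]
      have hba : T.inv.mult b a < J.mult b a := by
        refine lt_of_lt_of_le ?_ (hle b a)
        simp only [MultiInversionSet.addPair, if_pos h.lt, and_self, if_true]
        exact lt_min (Nat.lt_succ_self _) h.lt_bound
      intro y x
      rw [hR]
      exact rotate_le_of_le (fun {x y z} => hJ x y z) hTJ h.lt hba y x
  constructor
  · intro hZ
    rw [hZ.unique hleast, hR]
  · intro hZ
    rwa [eq_of_mult_eq (hZ.trans hR.symm)]

end SDecreasingTree

/-! ### Two ascents and the interval that they generate. -/

/-- The pairs whose multiplicity grows between `I` and the join of its rotations along the ascents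
`(a, b)` and `(c, d)`, where `a < c`. -/
def Grows {n : ℕ} (I : Fin n → Fin n → ℕ) (a b c d y x : Fin n) : Prop :=
  y = b ∧ Moves I a b x ∨ y = d ∧ Moves I c d x ∨ b = c ∧ y = d ∧ Moves I a b x

open Classical in
/-- The multiplicity function of the join of the rotations along `(a, b)` and `(c, d)`. -/
noncomputable def doubleRotate {n : ℕ} (I : Fin n → Fin n → ℕ) (a b c d y x : Fin n) : ℕ :=
  I y x + if Grows I a b c d y x then 1 else 0

section twoAscents

variable {n : ℕ} {s : Fin n → ℕ} {I L : Fin n → Fin n → ℕ} {a b c d : Fin n}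

theorem doubleRotate_of_grows {y x : Fin n} (h : Grows I a b c d y x) :
    doubleRotate I a b c d y x = I y x + 1 := by
  simp [doubleRotate, h]

theorem doubleRotate_of_not_grows {y x : Fin n} (h : ¬ Grows I a b c d y x) :
    doubleRotate I a b c d y x = I y x := by
  simp [doubleRotate, h]

theorem le_doubleRotate (y x : Fin n) : I y x ≤ doubleRotate I a b c d y x :=
  Nat.le_add_right _ _

theorem doubleRotate_le (y x : Fin n) : doubleRotate I a b c d y x ≤ I y x + 1 := by
  unfold doubleRotate
  split_ifs <;> omega

theorem rotate_le_doubleRotate_left (y x : Fin n) :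
    rotate I a b y x ≤ doubleRotate I a b c d y x := by
  by_cases h : y = b ∧ Moves I a b x
  · rw [doubleRotate_of_grows (Or.inl h)]
    exact rotate_le y x
  · rw [rotate, if_neg h]
    exact le_doubleRotate y x

theorem rotate_le_doubleRotate_right (y x : Fin n) :
    rotate I c d y x ≤ doubleRotate I a b c d y x := by
  by_cases h : y = d ∧ Moves I c d x
  · rw [doubleRotate_of_grows (Or.inr (Or.inl h))]
    exact rotate_le y x
  · rw [rotate, if_neg h]
    exact le_doubleRotate y x

/-- If `(a, b)` and `(b, d)` are ascents, the labels moved by the first one lie in the same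
subtree of `d`. -/
theorem Moves.mult_eq_above (hI : IsTreeInversionSet s I) (h1 : IsAscent s I a b) {z x : Fin n}
    (hx : Moves I a b x) (hz : b < z) : I z x = I z b := by
  have h2 := hx.mult_le hI (h1.lt.trans hz)
  have h3 := hI.planar (hx.le.trans_lt h1.lt) hz
  have h4 := hx.mult_lt h1
  have h5 := h1.above z hz
  omega

theorem Grows.lt (h1 : IsAscent s I a b) (h2 : IsAscent s I c d) {y x : Fin n}
    (h : Grows I a b c d y x) : x < y := by
  rcases h with ⟨rfl, h⟩ | ⟨rfl, h⟩ | ⟨rfl, rfl, h⟩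
  · exact h.le.trans_lt h1.lt
  · exact h.le.trans_lt h2.lt
  · exact h.le.trans_lt (h1.lt.trans h2.lt)

theorem Grows.mult_lt (hI : IsTreeInversionSet s I) (h1 : IsAscent s I a b)
    (h2 : IsAscent s I c d) {y x : Fin n} (h : Grows I a b c d y x) : I y x < s y := by
  rcases h with ⟨rfl, h⟩ | ⟨rfl, h⟩ | ⟨rfl, rfl, h⟩
  · exact h.mult_lt h1
  · exact h.mult_lt h2
  · rw [h.mult_eq_above hI h1 h2.lt]
    exact h2.lt_bound

theorem doubleRotate_le_bound (hI : IsTreeInversionSet s I) (h1 : IsAscent s I a b)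
    (h2 : IsAscent s I c d) (y x : Fin n) : doubleRotate I a b c d y x ≤ s y := by
  by_cases h : Grows I a b c d y x
  · rw [doubleRotate_of_grows h]
    exact h.mult_lt hI h1 h2
  · rw [doubleRotate_of_not_grows h]
    exact hI.le y x

/-- The third alternative of `Grows` is needed here: if `b = c`, raising `(d, b)` while `(b, x)` has
become positive forces `(d, x)` up as well, for every `x` moved along `(a, b)`. -/
theorem doubleRotate_transitive (hI : IsTreeInversionSet s I) (h1 : IsAscent s I a b)
    (h2 : IsAscent s I c d) (hac : a < c) {x y z : Fin n} (hxy : x < y) (hyz : y < z) :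
    doubleRotate I a b c d y x = 0 ∨ doubleRotate I a b c d z y ≤ doubleRotate I a b c d z x := by
  have hzx := le_doubleRotate (I := I) (a := a) (b := b) (c := c) (d := d) z x
  have hn : ∀ w, d < w → ¬ Grows I a b c d w d := by
    rintro w hdw (⟨rfl, h⟩ | ⟨rfl, -⟩ | ⟨-, rfl, -⟩)
    · exact (h.le.trans_lt (hac.trans h2.lt)).false
    · exact hdw.false
    · exact hdw.false
  by_cases hg : Grows I a b c d y x
  · right
    rcases hg with ⟨rfl, hx⟩ | ⟨rfl, hx⟩ | ⟨rfl, rfl, hx⟩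
    · have h3 := hx.mult_le hI (h1.lt.trans hyz)
      have h4 := h1.above z hyz
      by_cases hzb : Grows I a y c d z y
      · suffices I z x = I z y → Grows I a y c d z x by
          by_cases h5 : I z x = I z y
          · rw [doubleRotate_of_grows hzb, doubleRotate_of_grows (this h5), h5]
          · rw [doubleRotate_of_grows hzb]
            omega
        intro h5
        rcases hzb with ⟨rfl, -⟩ | ⟨rfl, hm⟩ | ⟨rfl, rfl, hm⟩
        · exact absurd hyz (lt_irrefl _)
        · rcases hm with rfl | ⟨hyc, hpos, hm⟩
          · exact Or.inr (Or.inr ⟨rfl, rfl, hx⟩)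
          · have h6 := h1.above c hyc
            have h7 := hx.mult_le hI hac
            exact Or.inr (Or.inl ⟨rfl, Or.inr ⟨hxy.trans hyc, by omega, by omega⟩⟩)
        · exact Or.inr (Or.inr ⟨rfl, rfl, hx⟩)
      · rw [doubleRotate_of_not_grows hzb]
        omega
    all_goals
      rw [doubleRotate_of_not_grows (hn z hyz)]
      have h4 := h2.above z hyz
      refine le_trans ?_ hzx
    · have h3 := hx.mult_le hI (h2.lt.trans hyz)
      omega
    · have h3 := hx.mult_eq_above hI h1 (h2.lt.trans hyz)
      omega
  · rw [doubleRotate_of_not_grows hg]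
    rcases Nat.eq_zero_or_pos (I y x) with h0 | h0
    · exact Or.inl h0
    right
    have h3 := (hI.transitive hxy hyz).resolve_left h0.ne'
    by_cases hg' : Grows I a b c d z y
    · rw [doubleRotate_of_grows hg']
      by_cases h4 : I z x = I z y
      · suffices Grows I a b c d z x by
          rw [doubleRotate_of_grows this, h4]
        rcases hg' with ⟨rfl, h⟩ | ⟨rfl, h⟩ | ⟨rfl, rfl, h⟩
        · exact Or.inl ⟨rfl, h.trans hI h1.lt hxy h0 h4⟩
        · exact Or.inr (Or.inl ⟨rfl, h.trans hI h2.lt hxy h0 h4⟩)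
        · have hyb := h.le.trans_lt h1.lt
          have h5 := (hI.transitive hxy hyb).resolve_left h0.ne'
          by_cases h6 : I b x = I b y
          · exact Or.inr (Or.inr ⟨rfl, rfl, h.trans hI h1.lt hxy h0 h6⟩)
          · have h7 := h.mult_eq_above hI h1 h2.lt
            exact Or.inr (Or.inl ⟨rfl, Or.inr ⟨hxy.trans hyb, by omega, by omega⟩⟩)
      · omega
    · rw [doubleRotate_of_not_grows hg']
      omega

theorem doubleRotate_planar (hI : IsTreeInversionSet s I) (h1 : IsAscent s I a b)
    (h2 : IsAscent s I c d) {x y z : Fin n} (hxy : x < y) (hyz : y < z) :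
    doubleRotate I a b c d y x = s y ∨ doubleRotate I a b c d z x ≤ doubleRotate I a b c d z y := by
  have hyx := le_doubleRotate (I := I) (a := a) (b := b) (c := c) (d := d) y x
  have hzy := le_doubleRotate (I := I) (a := a) (b := b) (c := c) (d := d) z y
  have hyx' := doubleRotate_le_bound hI h1 h2 y x
  have h0 := hI.planar hxy hyz
  by_cases hg : Grows I a b c d z x
  · have hzx := doubleRotate_of_grows hg
    rcases hg with ⟨rfl, hx⟩ | ⟨rfl, hx⟩ | ⟨rfl, rfl, hx⟩
    · have h3 := (h1.isTreeInversionSet_rotate hI).planar hxy hyz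
      rw [rotate_of_moves hx] at h3
      have h4 := rotate_le_doubleRotate_left (I := I) (a := a) (b := z) (c := c) (d := d) y x
      have h5 := rotate_le_doubleRotate_left (I := I) (a := a) (b := z) (c := c) (d := d) z y
      omega
    · have h3 := (h2.isTreeInversionSet_rotate hI).planar hxy hyz
      rw [rotate_of_moves hx] at h3
      have h4 := rotate_le_doubleRotate_right (I := I) (a := a) (b := b) (c := c) (d := z) y x
      have h5 := rotate_le_doubleRotate_right (I := I) (a := a) (b := b) (c := c) (d := z) z y
      omega
    · by_cases hg' : Grows I a b b z z y
      · have := doubleRotate_of_grows hg'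
        omega
      by_contra hcon
      have h3 : I z y = I z x := by omega
      have h4 : I y x ≠ s y := by omega
      have h5 := hx.mult_eq_above hI h1 h2.lt
      rcases lt_trichotomy y b with hyb | rfl | hby
      · have h6 : I b y = 0 := by
          by_contra h
          exact hg' (Or.inr (Or.inl ⟨rfl, Or.inr ⟨hyb, Nat.pos_of_ne_zero h, by omega⟩⟩))
        have h7 := (h1.isTreeInversionSet_rotate hI).planar hxy hyb
        rw [rotate_of_ne hyb.ne, rotate_of_moves hx] at h7
        by_cases h8 : Moves I a b y
        · exact hg' (Or.inr (Or.inr ⟨rfl, rfl, h8⟩))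
        · rw [rotate_of_not_moves h8] at h7
          omega
      · exact hg' (Or.inr (Or.inl ⟨rfl, Or.inl rfl⟩))
      · have h6 := h2.between y hby hyz (by omega)
        have h7 := hx.mult_eq_above hI h1 hby
        omega
  · rw [doubleRotate_of_not_grows hg]
    omega

theorem isTreeInversionSet_doubleRotate (hI : IsTreeInversionSet s I) (h1 : IsAscent s I a b)
    (h2 : IsAscent s I c d) (hac : a < c) : IsTreeInversionSet s (doubleRotate I a b c d) where
  eq_zero y x h := by
    rw [doubleRotate_of_not_grows fun hg => h (hg.lt h1 h2), hI.eq_zero y x h]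
  le := doubleRotate_le_bound hI h1 h2
  transitive := doubleRotate_transitive hI h1 h2 hac
  planar := doubleRotate_planar hI h1 h2

/-- If `x` lies in a subtree of `a` other than the first and the last one, and `x` and `a` lie in
the same subtree of `y`, then the multiplicities of `(y, x)` and `(y, a)` grow simultaneously. -/
theorem grows_iff_of_mem_inner (hL : IsTreeInversionSet s L) {x y : Fin n} (hay : a < y)
    (hx : x = a ∨ x < a ∧ 0 < L a x ∧ L a x < s a) (hI : I y x = I y a)
    (hxle : L y x ≤ I y x + 1) (hale : L y a ≤ I y a + 1) :
    I y x < L y x ↔ I y a < L y a := by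
  rcases hx with rfl | ⟨hxa, hpos, hlt⟩
  · exact Iff.rfl
  · have h1 := (hL.transitive hxa hay).resolve_left hpos.ne'
    have h2 := (hL.planar hxa hay).resolve_left hlt.ne
    omega

/-- The tree inversion sets between `I` and the join of its rotations along `(a, b)` and
`(c, d)`. -/
structure IsBetween (s : Fin n → ℕ) (I : Fin n → Fin n → ℕ) (a b c d : Fin n)
    (L : Fin n → Fin n → ℕ) : Prop where
  isTreeInversionSet : IsTreeInversionSet s L
  le : ∀ y x, I y x ≤ L y x
  ge : ∀ y x, L y x ≤ doubleRotate I a b c d y x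

theorem IsBetween.le_succ (hL : IsBetween s I a b c d L) (y x : Fin n) : L y x ≤ I y x + 1 :=
  (hL.ge y x).trans (doubleRotate_le y x)

theorem IsBetween.grows (hL : IsBetween s I a b c d L) {y x : Fin n} (h : I y x < L y x) :
    Grows I a b c d y x := by
  by_contra hg
  have := hL.ge y x
  rw [doubleRotate_of_not_grows hg] at this
  omega

theorem IsBetween.mult_eq (hL : IsBetween s I a b c d L) {y x : Fin n}
    (hg : ¬ Grows I a b c d y x) : L y x = I y x := by
  have h1 := hL.ge y x
  have h2 := hL.le y x
  rw [doubleRotate_of_not_grows hg] at h1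
  omega

/-- Row `a` is constant on the interval, and a label `x < a` moved with `a` has `0 < I a x < s a`;
such inner labels are tied to `a` by transitivity and planarity. The same works for `c`, except at
places where row `c` itself grows. -/
theorem Grows.cases (hI : IsTreeInversionSet s I) (h1 : IsAscent s I a b)
    (h2 : IsAscent s I c d) (hac : a < c) {y x : Fin n} (h : Grows I a b c d y x) :
    (y = b ∧ x ≤ a ∧ ∀ L, IsBetween s I a b c d L → (I y x < L y x ↔ I b a < L b a)) ∨
    (y = d ∧ x ≤ c ∧ ∀ L, IsBetween s I a b c d L → (I y x < L y x ↔ I d c < L d c)) ∨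
    (b = c ∧ y = d ∧ x ≤ a ∧ ∀ L, IsBetween s I a b c d L → (I y x < L y x ↔ I d a < L d a)) := by
  have ha : ∀ w, ¬ Grows I a b c d a w := by
    rintro w (⟨h, -⟩ | ⟨h, -⟩ | ⟨-, h, -⟩)
    · exact h1.lt.ne h
    · exact (hac.trans h2.lt).ne h
    · exact (hac.trans h2.lt).ne h
  have key : ∀ y L, a < y → Moves I a b x → I y x = I y a → IsBetween s I a b c d L →
      (I y x < L y x ↔ I y a < L y a) := by
    intro y L hay hx hy hL
    refine grows_iff_of_mem_inner hL.isTreeInversionSet hay ?_ hy (hL.le_succ y x) (hL.le_succ y a)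
    rw [hL.mult_eq (ha x)]
    exact hx.imp id fun hx => ⟨hx.1, hx.2.1, h1.below x hx.1 hx.2.2 hx.2.1⟩
  have key' : b = c → Moves I a b x → ∀ L, IsBetween s I a b c d L →
      (I d x < L d x ↔ I d a < L d a) := by
    rintro rfl hx L hL
    refine key d L (hac.trans h2.lt) hx ?_ hL
    rw [hx.mult_eq_above hI h1 h2.lt, h1.above d h2.lt]
  rcases h with ⟨rfl, hx⟩ | ⟨rfl, hx⟩ | ⟨hbc, rfl, hx⟩
  · exact Or.inl ⟨rfl, hx.le, fun L hL => key y L h1.lt hx hx.mult_eq hL⟩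
  -- Row `c` grows only if `b = c`, and then exactly at the labels moved along `(a, b)`. Those
  -- labels follow `(d, a)`; the remaining ones follow `(d, c)`.
  · by_cases hm : b = c ∧ Moves I a b x
    · exact Or.inr (Or.inr ⟨hm.1, rfl, hm.2.le, key' hm.1 hm.2⟩)
    · refine Or.inr (Or.inl ⟨rfl, hx.le, fun L hL => ?_⟩)
      refine grows_iff_of_mem_inner hL.isTreeInversionSet h2.lt ?_ hx.mult_eq (hL.le_succ y x)
        (hL.le_succ y c)
      have hc : ¬ Grows I a b c y c x := by
        rintro (⟨h, hx'⟩ | ⟨h, -⟩ | ⟨-, h, -⟩)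
        · exact hm ⟨h.symm, hx'⟩
        · exact h2.lt.ne h
        · exact h2.lt.ne h
      rw [hL.mult_eq hc]
      exact hx.imp id fun hx => ⟨hx.1, hx.2.1, h2.below x hx.1 hx.2.2 hx.2.1⟩
  · exact Or.inr (Or.inr ⟨hbc, rfl, hx.le, key' hbc hx⟩)

theorem IsBetween.le_iff (hI : IsTreeInversionSet s I) (h1 : IsAscent s I a b)
    (h2 : IsAscent s I c d) (hac : a < c) {L M : Fin n → Fin n → ℕ}
    (hL : IsBetween s I a b c d L) (hM : IsBetween s I a b c d M) :
    (∀ y x, L y x ≤ M y x) ↔ (I b a < L b a → I b a < M b a) ∧ (I d c < L d c → I d c < M d c) ∧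
      (b = c → I d a < L d a → I d a < M d a) := by
  constructor
  · exact fun h => ⟨fun h' => h'.trans_le (h b a), fun h' => h'.trans_le (h d c),
      fun _ h' => h'.trans_le (h d a)⟩
  · rintro ⟨hp, hq, hr⟩ y x
    by_cases hx : I y x < L y x
    · suffices I y x < M y x from (hL.le_succ y x).trans this
      rcases (hL.grows hx).cases hI h1 h2 hac with ⟨-, -, h⟩ | ⟨-, -, h⟩ | ⟨hbc, -, -, h⟩
      · exact (h M hM).2 (hp ((h L hL).1 hx))
      · exact (h M hM).2 (hq ((h L hL).1 hx))
      · exact (h M hM).2 (hr hbc ((h L hL).1 hx))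
    · exact (not_lt.1 hx).trans (hM.le y x)

/-- Transitivity at `a < b < d`. The partial converse `first_or_second_of_third` is planarity at the
same triple, with `I b a < s b`. -/
theorem IsBetween.third_of_both (h1 : IsAscent s I a b) (h2 : IsAscent s I c d)
    (hL : IsBetween s I a b c d L) (hbc : b = c) (hp : I b a < L b a)
    (hq : I d c < L d c) : I d a < L d a := by
  subst hbc
  have h3 := h1.above d h2.lt
  have h4 := (hL.isTreeInversionSet.transitive h1.lt h2.lt).resolve_left (by omega)
  omega

theorem IsBetween.first_or_second_of_third (h1 : IsAscent s I a b) (h2 : IsAscent s I c d)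
    (hL : IsBetween s I a b c d L) (hbc : b = c) (hr : I d a < L d a) :
    I b a < L b a ∨ I d c < L d c := by
  subst hbc
  have h3 := h1.above d h2.lt
  have h4 := hL.isTreeInversionSet.planar h1.lt h2.lt
  have h5 := h1.lt_bound
  omega

end twoAscents

/-! ### Recognizing diamonds, pentagons and hexagons. -/

theorem nonempty_orderIso_polygonPoset {P : Type*} [PartialOrder P] {u j : P} {p q : ℕ}
    {f : Fin p → P} {g : Fin q → P} (hf : ∀ i k, f i ≤ f k ↔ i ≤ k) (hg : ∀ i k, g i ≤ g k ↔ i ≤ k)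
    (huj : u < j) (huf : ∀ i, u < f i) (hfj : ∀ i, f i < j) (hug : ∀ i, u < g i)
    (hgj : ∀ i, g i < j) (hfg : ∀ i k, ¬ f i ≤ g k) (hgf : ∀ i k, ¬ g i ≤ f k)
    (hall : ∀ x, u ≤ x → x ≤ j → x = u ∨ x = j ∨ (∃ i, f i = x) ∨ ∃ i, g i = x) :
    Nonempty (Set.Icc u j ≃o PolygonPoset p q) := by
  let F : PolygonPoset p q → P := fun x =>
    WithBot.recBotCoe u (fun y => WithTop.recTopCoe j (Sum.elim f g) y) x
  have hmem : ∀ x, F x ∈ Set.Icc u j := by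
    intro x
    induction x using WithBot.recBotCoe with
    | bot => exact ⟨le_rfl, huj.le⟩
    | coe x =>
      induction x using WithTop.recTopCoe with
      | top => exact ⟨huj.le, le_rfl⟩
      | coe x =>
        rcases x with i | i
        · exact ⟨(huf i).le, (hfj i).le⟩
        · exact ⟨(hug i).le, (hgj i).le⟩
  have hle : ∀ x y, F x ≤ F y ↔ x ≤ y := by
    intro x y
    induction x using WithBot.recBotCoe with
    | bot => exact iff_of_true (hmem y).1 bot_le
    | coe x =>
      induction y using WithBot.recBotCoe with
      | bot =>
        have : ¬ ((x : PolygonPoset p q) ≤ ⊥) := by simp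
        refine iff_of_false (not_le_of_gt ?_) this
        induction x using WithTop.recTopCoe with
        | top => exact huj
        | coe x =>
          rcases x with i | i
          · exact huf i
          · exact hug i
      | coe y =>
        rw [WithBot.coe_le_coe]
        induction y using WithTop.recTopCoe with
        | top => exact iff_of_true (hmem x).2 le_top
        | coe y =>
          induction x using WithTop.recTopCoe with
          | top =>
            refine iff_of_false (not_le_of_gt ?_) (by simp)
            rcases y with i | i
            · exact hfj i
            · exact hgj i
          | coe x =>
            rw [WithTop.coe_le_coe]
            rcases x with i | i <;> rcases y with k | k
            · exact (hf i k).trans Sum.inl_le_inl_iff.symm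
            · exact iff_of_false (hfg i k) Sum.not_inl_le_inr
            · exact iff_of_false (hgf i k) Sum.not_inr_le_inl
            · exact (hg i k).trans Sum.inr_le_inr_iff.symm
  refine ⟨(RelIso.ofSurjective (OrderEmbedding.ofMapLEIff (fun x => (⟨F x, hmem x⟩ : Set.Icc u j))
    fun x y => hle x y) ?_).symm⟩
  rintro ⟨x, hux, hxj⟩
  rcases hall x hux hxj with rfl | rfl | ⟨i, rfl⟩ | ⟨i, rfl⟩
  · exact ⟨⊥, rfl⟩
  · exact ⟨WithBot.some (⊤ : WithTop (Fin p ⊕ Fin q)), rfl⟩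
  · exact ⟨(((Sum.inl i : Fin p ⊕ Fin q) : WithTop _) : WithBot _), rfl⟩
  · exact ⟨(((Sum.inr i : Fin p ⊕ Fin q) : WithTop _) : WithBot _), rfl⟩

/-- A nonempty set whose order is given by a single proposition is a chain of one or two
elements. -/
theorem exists_chain_enumeration {P : Type*} [PartialOrder P] {C r : P → Prop}
    (hC : ∃ x, C x) (hr : ∀ x y, C x → C y → (x ≤ y ↔ (r x → r y))) :
    ∃ m, (m = 1 ∨ m = 2) ∧ ∃ f : Fin m → P, (∀ i k, f i ≤ f k ↔ i ≤ k) ∧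
      ∀ x, C x ↔ ∃ i, f i = x := by
  have huniq : ∀ x y, C x → C y → (r x ↔ r y) → x = y := fun x y hx hy h =>
    le_antisymm ((hr x y hx hy).2 h.1) ((hr y x hy hx).2 h.2)
  by_cases h : ∃ x y, C x ∧ C y ∧ ¬ r x ∧ r y
  · obtain ⟨x, y, hx, hy, hrx, hry⟩ := h
    refine ⟨2, Or.inr rfl, ![x, y], ?_, fun z => ⟨fun hz => ?_, ?_⟩⟩
    · have h1 := (hr x y hx hy).2 fun _ => hry
      have h2 := mt (hr y x hy hx).1 fun h => hrx (h hry)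
      simp [Fin.forall_fin_two, h1, h2]
    · by_cases hrz : r z
      · exact ⟨1, huniq y z hy hz (iff_of_true hry hrz)⟩
      · exact ⟨0, huniq x z hx hz (iff_of_false hrx hrz)⟩
    · rintro ⟨i, rfl⟩
      fin_cases i
      · exact hx
      · exact hy
  · obtain ⟨x, hx⟩ := hC
    refine ⟨1, Or.inl rfl, fun _ => x, fun i k => iff_of_true le_rfl (Subsingleton.elim i k).le,
      fun z => ⟨fun hz => ⟨0, huniq x z hx hz ?_⟩, ?_⟩⟩
    · by_contra hne
      by_cases hrx : r x
      · exact h ⟨z, x, hz, hx, by tauto, hrx⟩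
      · exact h ⟨x, z, hx, hz, hrx, by tauto⟩
    · rintro ⟨-, rfl⟩
      exact hx

/-- An interval is a diamond, a pentagon or a hexagon if its order is encoded by three propositions
`p`, `q`, `r`, where `r` implies `p` or `q` and is implied by `p` and `q` together. -/
theorem polygon_of_propositions {P : Type*} [PartialOrder P] {u j : P} {p q r : P → Prop}
    (hle : ∀ x ∈ Set.Icc u j, ∀ y ∈ Set.Icc u j,
      (x ≤ y ↔ (p x → p y) ∧ (q x → q y) ∧ (r x → r y)))
    (hpq : ∀ x ∈ Set.Icc u j, p x → q x → r x) (hr : ∀ x ∈ Set.Icc u j, r x → p x ∨ q x)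
    (hp : ∃ x ∈ Set.Icc u j, p x ∧ ¬ q x) (hq : ∃ x ∈ Set.Icc u j, q x ∧ ¬ p x) :
    Nonempty (Set.Icc u j ≃o PolygonPoset 1 1) ∨ Nonempty (Set.Icc u j ≃o PolygonPoset 1 2) ∨
      Nonempty (Set.Icc u j ≃o PolygonPoset 2 2) := by
  obtain ⟨z, hz, hzp, hzq⟩ := id hp
  obtain ⟨w, hw, hwq, hwp⟩ := id hq
  have hu : u ∈ Set.Icc u j := ⟨le_rfl, hz.1.trans hz.2⟩
  have hj : j ∈ Set.Icc u j := ⟨hz.1.trans hz.2, le_rfl⟩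
  have hup : ¬ p u := fun h => hwp (((hle u hu w hw).1 hw.1).1 h)
  have huq : ¬ q u := fun h => hzq (((hle u hu z hz).1 hz.1).2.1 h)
  have hjp : p j := ((hle z hz j hj).1 hz.2).1 hzp
  have hjq : q j := ((hle w hw j hj).1 hw.2).2.1 hwq
  have hur : ¬ r u := fun h => (hr u hu h).elim hup huq
  have hjr : r j := hpq j hj hjp hjq
  -- Elements satisfying neither `p` nor `q` equal `u`, and elements satisfying both equal `j`.
  -- Those satisfying exactly one form the two sides, on each of which only `r` is left to vary.
  obtain ⟨m, hm, f, hf, hf'⟩ := exists_chain_enumeration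
    (C := fun x => x ∈ Set.Icc u j ∧ p x ∧ ¬ q x) (r := r) hp fun x y hx hy => by
      rw [hle x hx.1 y hy.1]
      simp [hx.2.2, hy.2.1]
  obtain ⟨k, hk, g, hg, hg'⟩ := exists_chain_enumeration
    (C := fun x => x ∈ Set.Icc u j ∧ q x ∧ ¬ p x) (r := r) hq fun x y hx hy => by
      rw [hle x hx.1 y hy.1]
      simp [hx.2.2, hy.2.1]
  have hfC := fun i => (hf' (f i)).2 ⟨i, rfl⟩
  have hgC := fun i => (hg' (g i)).2 ⟨i, rfl⟩
  have huf : ∀ i, u < f i := fun i => (hfC i).1.1.lt_of_ne fun h => hup (h ▸ (hfC i).2.1)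
  have hug : ∀ i, u < g i := fun i => (hgC i).1.1.lt_of_ne fun h => huq (h ▸ (hgC i).2.1)
  have hfj : ∀ i, f i < j := fun i => (hfC i).1.2.lt_of_ne fun h => (hfC i).2.2 (h ▸ hjq)
  have hgj : ∀ i, g i < j := fun i => (hgC i).1.2.lt_of_ne fun h => (hgC i).2.2 (h ▸ hjp)
  have hfg : ∀ i l, ¬ f i ≤ g l := fun i l h =>
    (hgC l).2.2 (((hle _ (hfC i).1 _ (hgC l).1).1 h).1 (hfC i).2.1)
  have hgf : ∀ i l, ¬ g i ≤ f l := fun i l h =>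
    (hfC l).2.2 (((hle _ (hgC i).1 _ (hfC l).1).1 h).2.1 (hgC i).2.1)
  have hall : ∀ x, u ≤ x → x ≤ j → x = u ∨ x = j ∨ (∃ i, f i = x) ∨ ∃ i, g i = x := by
    intro x hux hxj
    have hx : x ∈ Set.Icc u j := ⟨hux, hxj⟩
    by_cases hpx : p x <;> by_cases hqx : q x
    · refine Or.inr (Or.inl (le_antisymm hxj ((hle j hj x hx).2 ?_)))
      exact ⟨fun _ => hpx, fun _ => hqx, fun _ => hpq x hx hpx hqx⟩
    · exact Or.inr (Or.inr (Or.inl ((hf' x).1 ⟨hx, hpx, hqx⟩)))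
    · exact Or.inr (Or.inr (Or.inr ((hg' x).1 ⟨hx, hqx, hpx⟩)))
    · refine Or.inl (le_antisymm ((hle x hx u hu).2 ?_) hux)
      exact ⟨fun h => absurd h hpx, fun h => absurd h hqx,
        fun h => ((hr x hx h).elim hpx hqx).elim⟩
  have huj := hz.1.trans hz.2 |>.lt_of_ne fun h => hup (h ▸ hjp)
  have h1 := nonempty_orderIso_polygonPoset hf hg huj huf hfj hug hgj hfg hgf hall
  have h2 := nonempty_orderIso_polygonPoset hg hf huj hug hgj huf hfj hgf hfg fun x hux hxj =>
    (hall x hux hxj).imp id fun h => h.imp id Or.symm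
  rcases hm with rfl | rfl <;> rcases hk with rfl | rfl
  · exact Or.inl h1
  · exact Or.inr (Or.inl h1)
  · exact Or.inr (Or.inl h2)
  · exact Or.inr (Or.inr h1)

/-! ### Steps of saturated chains. -/

namespace SaturatedChain

variable {P Λ : Type*} [PartialOrder P] {lam : EdgeLabeling P Λ}

theorem le {x y : P} (c : SaturatedChain x y) : x ≤ y := by
  induction c with
  | nil => exact le_rfl
  | cons h _ ih => exact h.le.trans ih

theorem exists_of_mem_labels {u j : P} (c : SaturatedChain u j) {l : Λ} (hl : l ∈ c.labels lam) :
    ∃ x y, ∃ h : x ⋖ y, u ≤ x ∧ y ≤ j ∧ lam h = l := by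
  induction c with
  | nil => simp [labels] at hl
  | cons h c ih =>
    rcases List.mem_cons.1 hl with rfl | hl
    · exact ⟨_, _, h, le_rfl, c.le, rfl⟩
    · obtain ⟨x, y, h', hx, hy, hxy⟩ := ih hl
      exact ⟨x, y, h', h.le.trans hx, hy, hxy⟩

theorem exists_step {Φ : P → Prop} {u j : P} (c : SaturatedChain u j) (hu : ¬ Φ u) (hj : Φ j) :
    ∃ x y, ∃ h : x ⋖ y, u ≤ x ∧ y ≤ j ∧ ¬ Φ x ∧ Φ y ∧ lam h ∈ c.labels lam := by
  induction c with
  | nil => exact absurd hj hu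
  | @cons x y z h c ih =>
    by_cases hy : Φ y
    · exact ⟨x, y, h, le_rfl, c.le, hu, hy, List.mem_cons_self⟩
    · obtain ⟨x', y', h', h1, h2, h3, h4, h5⟩ := ih hy hj
      exact ⟨x', y', h', h.le.trans h1, h2, h3, h4, List.mem_cons_of_mem _ h5⟩

end SaturatedChain

/-! ### Covers, labels and polygons in the `s`-weak order. -/

namespace SDecreasingTree

variable {n : ℕ} {s : Fin n → ℕ} {T Z Q J L M : SDecreasingTree s} {a b c d : Fin n}

theorem IsRotation.lt_mult_iff (h : IsRotation T Z a b) {y x : Fin n} :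
    T.inv.mult y x < Z.inv.mult y x ↔ y = b ∧ Moves T.inv.mult a b x := by
  rw [(isRotation_iff.1 h).2, lt_rotate_iff]

theorem IsRotation.lt_mult (h : IsRotation T Z a b) : T.inv.mult b a < Z.inv.mult b a :=
  h.lt_mult_iff.2 ⟨rfl, Or.inl rfl⟩

/-- `b` is the only row in which `T` and `Z` differ, and `a` is the largest label at which they
differ there. -/
theorem IsRotation.unique {a' b' : Fin n} (h : IsRotation T Z a b) (h' : IsRotation T Z a' b') :
    a = a' ∧ b = b' := by
  obtain ⟨h1, h2⟩ := h.lt_mult_iff.1 h'.lt_mult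
  obtain ⟨-, h4⟩ := h'.lt_mult_iff.1 h.lt_mult
  exact ⟨le_antisymm h4.le h2.le, h1.symm⟩

theorem exists_isRotation_of_covBy (h : T ⋖ Z) : ∃ a b, IsRotation T Z a b := by
  obtain ⟨a, b, hab, hlt⟩ := T.isTreeInversionSet_inv.exists_isAscent Z.isTreeInversionSet_inv
    h.le fun he => h.ne (eq_of_mult_eq he)
  obtain ⟨R, hR⟩ := exists_inv_mult_eq (hab.isTreeInversionSet_rotate T.isTreeInversionSet_inv)
  have hrot : IsRotation T R a b := isRotation_iff.2 ⟨hab, hR⟩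
  have hTR : T ≤ R := fun y x => by
    rw [hR]
    exact le_rotate y x
  have hRZ : R ≤ Z := fun y x => by
    rw [hR]
    exact rotate_le_of_le Z.isTreeInversionSet_inv.transitive h.le hab.lt hlt y x
  have hne : T ≠ R := by
    rintro rfl
    exact hrot.lt_mult.false
  refine ⟨a, b, ?_⟩
  rwa [← (h.eq_or_eq hTR hRZ).resolve_left hne.symm]

/-- An ascent is determined by its smaller label. -/
theorem IsRotation.eq_of_label_eq (hZ : IsRotation T Z a b) (hQ : IsRotation T Q a d) : Z = Q := by
  obtain ⟨h1, hZ⟩ := isRotation_iff.1 hZ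
  obtain ⟨h2, hQ⟩ := isRotation_iff.1 hQ
  -- If `b < d`, then `b` is an intermediate ancestor for the ascent `(a, d)`, so the multiplicity
  -- at `(b, a)` would be `s b`, leaving no room for the ascent `(a, b)`.
  have key : ∀ {b d}, IsAscent s T.inv.mult a b → IsAscent s T.inv.mult a d → ¬ b < d :=
    fun h1 h2 hlt => h1.lt_bound.ne (h2.between _ h1.lt hlt (h1.above _ hlt).symm)
  obtain rfl : b = d := le_antisymm (not_lt.1 (key h2 h1)) (not_lt.1 (key h1 h2))
  exact eq_of_mult_eq (hZ.trans hQ.symm)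

/-- `doubleRotate` is realized by a tree above both rotations, hence above `J`. Only this inequality
is needed, not that it equals the join. -/
theorem isBetween_of_mem_Icc (hZ : IsRotation T Z a b) (hQ : IsRotation T Q c d) (hac : a < c)
    (hJ : IsLUB {Z, Q} J) (hL : L ∈ Set.Icc T J) :
    IsBetween s T.inv.mult a b c d L.inv.mult := by
  obtain ⟨h1, hZ⟩ := isRotation_iff.1 hZ
  obtain ⟨h2, hQ⟩ := isRotation_iff.1 hQ
  obtain ⟨G, hG⟩ := exists_inv_mult_eq
    (isTreeInversionSet_doubleRotate T.isTreeInversionSet_inv h1 h2 hac)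
  have hJG : J ≤ G := by
    refine hJ.2 ?_
    rintro K (rfl | rfl) y x
    · rw [hZ, hG]
      exact rotate_le_doubleRotate_left y x
    · rw [hQ, hG]
      exact rotate_le_doubleRotate_right y x
  refine ⟨L.isTreeInversionSet_inv, hL.1, fun y x => ?_⟩
  rw [← hG]
  exact (hL.2.trans hJG) y x

theorem polygon_of_isRotation (hZ : IsRotation T Z a b) (hQ : IsRotation T Q c d) (hac : a < c)
    (hTZ : T ≤ Z) (hTQ : T ≤ Q) (hJ : IsLUB {Z, Q} J) :
    Nonempty (Set.Icc T J ≃o PolygonPoset 1 1) ∨ Nonempty (Set.Icc T J ≃o PolygonPoset 1 2) ∨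
      Nonempty (Set.Icc T J ≃o PolygonPoset 2 2) := by
  have hI := T.isTreeInversionSet_inv
  have h1 := (isRotation_iff.1 hZ).1
  have h2 := (isRotation_iff.1 hQ).1
  have hB := fun L hL => isBetween_of_mem_Icc (L := L) hZ hQ hac hJ hL
  have hZm : Z ∈ Set.Icc T J := ⟨hTZ, hJ.1 (Or.inl rfl)⟩
  have hQm : Q ∈ Set.Icc T J := ⟨hTQ, hJ.1 (Or.inr rfl)⟩
  refine polygon_of_propositions (p := fun L => T.inv.mult b a < L.inv.mult b a)
    (q := fun L => T.inv.mult d c < L.inv.mult d c)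
    -- For `b ≠ c` there is no third pair; the conjunction of the first two bits then stands in for
    -- `r`, and it is false on both sides of the polygon.
    (r := fun L => (b = c ∧ T.inv.mult d a < L.inv.mult d a) ∨
      (b ≠ c ∧ T.inv.mult b a < L.inv.mult b a ∧ T.inv.mult d c < L.inv.mult d c)) ?_ ?_ ?_ ?_ ?_
  · intro L hL M hM
    rw [le_iff, (hB L hL).le_iff hI h1 h2 hac (hB M hM)]
    by_cases hbc : b = c
    · simp [hbc]
    · simp only [hbc, false_and, ne_eq, not_false_eq_true, true_and, false_or]
      tauto
  · intro L hL hp hq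
    by_cases hbc : b = c
    · exact Or.inl ⟨hbc, (hB L hL).third_of_both h1 h2 hbc hp hq⟩
    · exact Or.inr ⟨hbc, hp, hq⟩
  · rintro L hL (⟨hbc, hr⟩ | ⟨-, hp, -⟩)
    · exact (hB L hL).first_or_second_of_third h1 h2 hbc hr
    · exact Or.inl hp
  · refine ⟨Z, hZm, hZ.lt_mult, fun h => ?_⟩
    exact (hZ.lt_mult_iff.1 h).2.le.not_gt hac
  · refine ⟨Q, hQm, hQ.lt_mult, fun h => ?_⟩
    obtain ⟨rfl, h3 | ⟨-, hpos, heq⟩⟩ := hQ.lt_mult_iff.1 h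
    · exact hac.ne h3
    · have h3 := h1.between c hac h2.lt heq.symm
      exact (h2.below a hac heq hpos).ne h3

theorem label_eq_of_isRotation (hZ : IsRotation T Z a b) (hQ : IsRotation T Q c d) (hac : a < c)
    (hJ : IsLUB {Z, Q} J) (hTL : T ≤ L) (hMJ : M ≤ J) (hLM : L ≤ M) {l e : Fin n}
    (h : IsRotation L M l e) : l = a ∨ l = c := by
  have hI := T.isTreeInversionSet_inv
  have h1 := (isRotation_iff.1 hZ).1
  have h2 := (isRotation_iff.1 hQ).1
  have hL := isBetween_of_mem_Icc hZ hQ hac hJ ⟨hTL, hLM.trans hMJ⟩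
  have hM := isBetween_of_mem_Icc hZ hQ hac hJ ⟨hTL.trans hLM, hMJ⟩
  have hlt := h.lt_mult
  have h3 := hL.le e l
  have h4 := hM.le_succ e l
  have hnl : ¬ T.inv.mult e l < L.inv.mult e l := by omega
  have hm : T.inv.mult e l < M.inv.mult e l := by omega
  -- The key pair `(y, x)` grows in the same step as `(e, l)`. A rotation labeled `l` moves no label
  -- above `l`, so `x ≤ l`.
  have key : ∀ {y x}, l ≤ x → (T.inv.mult e l < L.inv.mult e l ↔ T.inv.mult y x < L.inv.mult y x) →
      (T.inv.mult e l < M.inv.mult e l ↔ T.inv.mult y x < M.inv.mult y x) → l = x := by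
    intro y x hlx hLx hMx
    have h5 := mt hLx.2 hnl
    have h6 := hMx.1 hm
    exact le_antisymm hlx (h.lt_mult_iff.1 (show L.inv.mult y x < _ by omega)).2.le
  rcases (hM.grows hm).cases hI h1 h2 hac with ⟨-, hle, h5⟩ | ⟨-, hle, h5⟩ | ⟨-, -, hle, h5⟩
  · exact Or.inl (key hle (h5 _ hL) (h5 _ hM))
  · exact Or.inr (key hle (h5 _ hL) (h5 _ hM))
  · exact Or.inl (key hle (h5 _ hL) (h5 _ hM))

/-- A cover in the interval along which the multiplicity of `(b, a)` grows has label `a`. -/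
theorem label_eq_left (hZ : IsRotation T Z a b) (hQ : IsRotation T Q c d) (hac : a < c)
    (hJ : IsLUB {Z, Q} J) (hTL : T ≤ L) (hMJ : M ≤ J) (hLM : L ≤ M) {l e : Fin n}
    (h : IsRotation L M l e) (hLa : ¬ T.inv.mult b a < L.inv.mult b a)
    (hMa : T.inv.mult b a < M.inv.mult b a) : l = a := by
  refine (label_eq_of_isRotation hZ hQ hac hJ hTL hMJ hLM h).resolve_right ?_
  rintro rfl
  have h1 := (isRotation_iff.1 hZ).1
  have h2 := (isRotation_iff.1 hQ).1
  have hL := isBetween_of_mem_Icc hZ hQ hac hJ ⟨hTL, hLM.trans hMJ⟩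
  have hM := isBetween_of_mem_Icc hZ hQ hac hJ ⟨hTL.trans hLM, hMJ⟩
  obtain ⟨rfl, h3 | ⟨-, hpos, heq⟩⟩ :=
    h.lt_mult_iff.1 (show L.inv.mult b a < M.inv.mult b a by omega)
  · exact hac.ne h3
  have hlt := h.lt_mult
  have h4 := hL.le b a
  have h5 := hL.le b l
  have h6 := hM.le_succ b l
  -- Were the label `c`, the pair `(b, c)` would grow too. As `c > a`, this leaves only `b = d`,
  -- where row `c` is unchanged; then `(a, b)` requires the value `s c` at `(c, a)`, while `(c, d)`
  -- requires a smaller one.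
  obtain ⟨-, h7⟩ | ⟨hbd, -⟩ | ⟨rfl, -, h7⟩ :=
    hM.grows (show T.inv.mult b l < M.inv.mult b l by omega)
  · exact h7.le.not_gt hac
  · subst hbd
    have h7 : L.inv.mult l a = T.inv.mult l a := by
      refine hL.mult_eq ?_
      rintro (⟨h, -⟩ | ⟨h, -⟩ | ⟨h, -⟩)
      · exact h2.lt.ne h
      · exact h2.lt.ne h
      · exact h2.lt.ne h.symm
    have h8 := h1.between l hac h2.lt (by omega)
    exact (h2.below a hac (by omega) (by omega)).ne h8
  · exact h7.le.not_gt hac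

/-- A cover in the interval along which the multiplicity of `(d, c)` grows has label `c`. -/
theorem label_eq_right (hZ : IsRotation T Z a b) (hQ : IsRotation T Q c d) (hac : a < c)
    (hJ : IsLUB {Z, Q} J) (hTL : T ≤ L) (hMJ : M ≤ J) (hLM : L ≤ M) {l e : Fin n}
    (h : IsRotation L M l e) (hLc : ¬ T.inv.mult d c < L.inv.mult d c)
    (hMc : T.inv.mult d c < M.inv.mult d c) : l = c := by
  refine (label_eq_of_isRotation hZ hQ hac hJ hTL hMJ hLM h).resolve_left ?_
  rintro rfl
  have := (h.lt_mult_iff.1 (show L.inv.mult d c < M.inv.mult d c by omega)).2.le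
  exact this.not_gt hac

/-- The labeling of the cover relations of the `s`-weak order by the smaller label of the ascent. -/
noncomputable def ascentLabeling : EdgeLabeling (SDecreasingTree s) (Fin n) :=
  fun _ _ h => (exists_isRotation_of_covBy h).choose

theorem exists_isRotation_ascentLabeling (h : T ⋖ Z) : ∃ b, IsRotation T Z (ascentLabeling h) b :=
  (exists_isRotation_of_covBy h).choose_spec

theorem ascentLabeling_eq (h : T ⋖ Z) (hab : IsRotation T Z a b) : ascentLabeling h = a := by
  obtain ⟨b', h'⟩ := exists_isRotation_ascentLabeling h
  exact (h'.unique hab).1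

theorem ascentLabeling_mem (hZ : IsRotation T Z a b) (hQ : IsRotation T Q c d) (hac : a < c)
    (hJ : IsLUB {Z, Q} J) (C : SaturatedChain T J) :
    (a ∈ C.labels ascentLabeling ∧ c ∈ C.labels ascentLabeling) ∧
      ∀ l ∈ C.labels ascentLabeling, l = a ∨ l = c := by
  refine ⟨⟨?_, ?_⟩, fun l hl => ?_⟩
  -- `(b, a)` has grown at `J` but not at `T`; the step of the chain at which it starts to grow
  -- carries the label `a`.
  · obtain ⟨L, M, h, hTL, hMJ, h1, h2, h3⟩ := C.exists_step (lam := ascentLabeling)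
      (Φ := fun L => T.inv.mult b a < L.inv.mult b a) (lt_irrefl _)
      (hZ.lt_mult.trans_le (hJ.1 (Or.inl rfl) b a))
    obtain ⟨e, he⟩ := exists_isRotation_ascentLabeling h
    rwa [label_eq_left hZ hQ hac hJ hTL hMJ h.le he h1 h2] at h3
  · obtain ⟨L, M, h, hTL, hMJ, h1, h2, h3⟩ := C.exists_step (lam := ascentLabeling)
      (Φ := fun L => T.inv.mult d c < L.inv.mult d c) (lt_irrefl _)
      (hQ.lt_mult.trans_le (hJ.1 (Or.inr rfl) d c))
    obtain ⟨e, he⟩ := exists_isRotation_ascentLabeling h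
    rwa [label_eq_right hZ hQ hac hJ hTL hMJ h.le he h1 h2] at h3
  · obtain ⟨L, M, h, hTL, hMJ, rfl⟩ := C.exists_of_mem_labels hl
    obtain ⟨e, he⟩ := exists_isRotation_ascentLabeling h
    exact label_eq_of_isRotation hZ hQ hac hJ hTL hMJ h.le he

theorem ascentLabeling_ne (hZ : T ⋖ Z) (hQ : T ⋖ Q) (hne : Z ≠ Q) :
    ascentLabeling hZ ≠ ascentLabeling hQ := by
  obtain ⟨b, hb⟩ := exists_isRotation_ascentLabeling hZ
  obtain ⟨d, hd⟩ := exists_isRotation_ascentLabeling hQ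
  intro h
  rw [h] at hb
  exact hne (hb.eq_of_label_eq hd)

theorem isSBLabeling_ascentLabeling : IsSBLabeling (ascentLabeling (s := s)) := by
  have key : ∀ ⦃T Z Q : SDecreasingTree s⦄ (hZ : T ⋖ Z) (hQ : T ⋖ Q), Z ≠ Q → ∀ J,
      IsLUB {Z, Q} J → ∀ C : SaturatedChain T J,
      (ascentLabeling hZ ∈ C.labels ascentLabeling ∧ ascentLabeling hQ ∈ C.labels ascentLabeling) ∧
        ∀ l ∈ C.labels ascentLabeling, l = ascentLabeling hZ ∨ l = ascentLabeling hQ := by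
    intro T Z Q hZ hQ hne J hJ C
    obtain ⟨b, hb⟩ := exists_isRotation_ascentLabeling hZ
    obtain ⟨d, hd⟩ := exists_isRotation_ascentLabeling hQ
    rcases lt_or_gt_of_ne (ascentLabeling_ne hZ hQ hne) with h | h
    · exact ascentLabeling_mem hb hd h hJ C
    · rw [Set.pair_comm] at hJ
      have h1 := ascentLabeling_mem hd hb h hJ C
      exact ⟨h1.1.symm, fun l hl => (h1.2 l hl).symm⟩
  exact {
    finite := inferInstance
    exists_join := exists_isLUB_pair
    exists_meet := exists_isGLB_pair_of_finite exists_isBot exists_isLUB_pair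
    label_ne := fun _ _ _ hv hw h => ascentLabeling_ne hv hw h
    label_mem := fun _ _ _ hv hw h J hJ C => (key hv hw h J hJ C).1
    mem_label := fun _ _ _ hv hw h J hJ C => (key hv hw h J hJ C).2 }

end SDecreasingTree

theorem mainTheorem1 (n : ℕ) (s : Fin n → ℕ) :
    (∀ T Z : SDecreasingTree s, T ⋖ Z →
      ∃! p : Fin n × Fin n, SDecreasingTree.IsRotation T Z p.1 p.2) ∧
    (∃ lam : EdgeLabeling (SDecreasingTree s) (Fin n),
      (∀ (T Z : SDecreasingTree s) (h : T ⋖ Z) (a b : Fin n),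
        SDecreasingTree.IsRotation T Z a b → lam h = a) ∧
      IsSBLabeling lam) ∧
    (∀ T Z Q J : SDecreasingTree s, T ⋖ Z → T ⋖ Q → Z ≠ Q → IsLUB {Z, Q} J →
      Nonempty (Set.Icc T J ≃o PolygonPoset 1 1) ∨
      Nonempty (Set.Icc T J ≃o PolygonPoset 1 2) ∨
      Nonempty (Set.Icc T J ≃o PolygonPoset 2 2)) := by
  refine ⟨fun T Z h => ?_, ⟨SDecreasingTree.ascentLabeling,
    fun T Z h a b hab => SDecreasingTree.ascentLabeling_eq h hab,
    SDecreasingTree.isSBLabeling_ascentLabeling⟩, fun T Z Q J hZ hQ hne hJ => ?_⟩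
  · obtain ⟨a, b, hab⟩ := SDecreasingTree.exists_isRotation_of_covBy h
    refine ⟨(a, b), hab, fun p hp => ?_⟩
    obtain ⟨h1, h2⟩ := SDecreasingTree.IsRotation.unique hp hab
    exact Prod.ext h1 h2
  · obtain ⟨b, hb⟩ := SDecreasingTree.exists_isRotation_ascentLabeling hZ
    obtain ⟨d, hd⟩ := SDecreasingTree.exists_isRotation_ascentLabeling hQ
    rcases lt_or_gt_of_ne (SDecreasingTree.ascentLabeling_ne hZ hQ hne) with h | h
    · exact SDecreasingTree.polygon_of_isRotation hb hd h hZ.le hQ.le hJ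
    · rw [Set.pair_comm] at hJ
      exact SDecreasingTree.polygon_of_isRotation hd hb h hQ.le hZ.le hJ
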